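/- Let $K$ be a field, let $n\ge 0$ be an integer, and let $A=K[x_1,\dots,x_n]$ with the standard grading ($\deg x_i=1$). For integers $a\ge 0$ and $d\ge 1$ write $a=\binom{k_d}{d}+\binom{k_{d-1}}{d-1}+\dots+\binom{k_1}{1}$ with $k_d>k_{d-1}>\dots>k_1\ge 0$ (this representation exists and is unique, with the convention $\binom{k}{i}=0$ for $k<i$), and put $a^{\langle d\rangle}=\binom{k_d+1}{d+1}+\binom{k_{d-1}+1}{d}+\dots+\binom{k_1+1}{2}$; in particular $0^{\langle d\rangle}=0$. Let $H:\mathbb N\to\mathbb N$ satisfy $H(0)=1$, $H(1)\le n$ and $H(q+1)\le H(q)^{\langle q\rangle}$ for all $q\ge 1$. Let $\mathcal A_H$ be the set of integers $0\le r\le n$ for which there is a homogeneous ideal $I$ of $A$ such that $\dim_K (A/I)_q=H(q)$ for all $q\ge 0$ and $\operatorname{depth} A/I=r$, where $\operatorname{depth} A/I$ is the maximal length of an $A/I$-regular sequence in the ideal $(x_1,\dots,x_n)$. Put $\Delta^0(H)=H$ and, for $p\ge 1$, $\Delta^p(H)(0)=1$ and $\Delta^p(H)(q)=\Delta^{p-1}(H)(q)-\Delta^{p-1}(H)(q-1)$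 for $q\ge 1$. Then the maxima of both of the following sets exist, and \[ \max\mathcal A_H=\max\bigl\{p\ge 0:\ \Delta^p(H)(q)\ge 0 \text{ for all } q\ge 0,\ \text{and } \Delta^p(H)(q+1)\le \Delta^p(H)(q)^{\langle q\rangle}\text{ for all } q\ge 1\bigr\}. \] -/

import Mathlib

/-- `k 1 < k 2 < ⋯ < k d` is the `d`-th Macaulay representation of `a`:
`a = C(k d, d) + C(k (d-1), d-1) + ⋯ + C(k 1, 1)` with `k d > ⋯ > k 1 ≥ 0`. -/
def IsMacaulayRep (d a : ℕ) (k : ℕ → ℕ) : Prop :=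
  StrictMonoOn k (Set.Icc 1 d) ∧ a = ∑ i ∈ Finset.Icc 1 d, (k i).choose i

/-- Macaulay's `a^{⟨d⟩}`, computed greedily: if `k` is the largest integer with `C(k, d) ≤ a`,
then `a^{⟨d⟩} = C(k + 1, d + 1) + (a - C(k, d))^{⟨d - 1⟩}`.
The theorems `exists_isMacaulayRep` and `macaulayPow_eq_sum` below show that for `d ≥ 1`
this is `C(k d + 1, d + 1) + ⋯ + C(k 1 + 1, 2)` for the Macaulay representation `k` of `a`. -/
def macaulayPow : ℕ → ℕ → ℕ
  | 0, _ => 0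
  | d + 1, a =>
    (Nat.findGreatest (fun k => k.choose (d + 1) ≤ a) (a + d) + 1).choose (d + 2) +
      macaulayPow d (a - (Nat.findGreatest (fun k => k.choose (d + 1) ≤ a) (a + d)).choose (d + 1))

theorem lt_choose_add_succ (a d : ℕ) : a < (a + d + 1).choose (d + 1) := by
  induction d with
  | zero => simp
  | succ d ih =>
    have h := Nat.choose_succ_succ (a + d + 1) (d + 1)
    have h2 : (a + (d + 1) + 1).choose (d + 1 + 1) = (a + d + 1 + 1).choose (d + 1 + 1) := by
      congr 1
    rw [h2]
    simp only [Nat.succ_eq_add_one] at h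
    omega

theorem sum_choose_lt {d : ℕ} {k : ℕ → ℕ} (hk : StrictMonoOn k (Set.Icc 1 d)) {m : ℕ}
    (hm : ∀ i ∈ Set.Icc 1 d, k i < m) :
    ∑ i ∈ Finset.Icc 1 d, (k i).choose i < m.choose d := by
  induction d generalizing m with
  | zero => simp
  | succ d ih =>
    rw [Finset.sum_Icc_succ_top (by omega)]
    have h1 := ih (m := k (d + 1)) (hk.mono (Set.Icc_subset_Icc_right (by omega)))
      (fun i hi => hk ⟨hi.1, by have := hi.2; omega⟩ ⟨by omega, le_refl _⟩
        (by have := hi.2; omega))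
    have h2 : (k (d + 1) + 1).choose (d + 1) ≤ m.choose (d + 1) :=
      Nat.choose_le_choose _ (hm (d + 1) ⟨by omega, le_refl _⟩)
    have h3 := Nat.choose_succ_succ (k (d + 1)) d
    simp only [Nat.succ_eq_add_one] at h3
    omega

theorem exists_rep_of_lt_choose {d a m : ℕ} (h : a < m.choose d) :
    ∃ k : ℕ → ℕ, IsMacaulayRep d a k ∧ ∀ i ∈ Set.Icc 1 d, k i < m := by
  induction d generalizing a m with
  | zero =>
    refine ⟨id, ⟨strictMono_id.strictMonoOn _, ?_⟩, fun i hi => ?_⟩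
    · simpa using h
    · have := hi.1; have := hi.2; omega
  | succ d ih =>
    set c := Nat.findGreatest (fun k => k.choose (d + 1) ≤ a) m with hc
    have hc1 : c.choose (d + 1) ≤ a :=
      Nat.findGreatest_spec (P := fun k => k.choose (d + 1) ≤ a) (Nat.zero_le m) (by simp)
    have hcm : c < m := by
      by_contra hcon
      have := Nat.choose_le_choose (d + 1) (not_lt.mp hcon)
      omega
    have hc2 : a < (c + 1).choose (d + 1) := by
      have := Nat.findGreatest_is_greatest (P := fun k => k.choose (d + 1) ≤ a)
        (n := m) (k := c + 1) (by omega) (by omega)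
      omega
    have h3 := Nat.choose_succ_succ c d
    simp only [Nat.succ_eq_add_one] at h3
    obtain ⟨k, ⟨hk, hs⟩, hlt⟩ := ih (a := a - c.choose (d + 1)) (m := c) (by omega)
    refine ⟨fun i => if i = d + 1 then c else k i, ⟨?_, ?_⟩, ?_⟩
    · intro i hi j hj hij
      obtain ⟨hi1, hi2⟩ := hi
      obtain ⟨hj1, hj2⟩ := hj
      have hi' : i ≠ d + 1 := by omega
      by_cases hj' : j = d + 1
      · simpa [hi', hj'] using hlt i ⟨hi1, by omega⟩
      · simpa [hi', hj'] using hk ⟨hi1, by omega⟩ ⟨hj1, by omega⟩ hij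
    · rw [Finset.sum_Icc_succ_top (by omega)]
      have : ∑ i ∈ Finset.Icc 1 d, (if i = d + 1 then c else k i).choose i =
          ∑ i ∈ Finset.Icc 1 d, (k i).choose i := by
        refine Finset.sum_congr rfl fun i hi => ?_
        have := (Finset.mem_Icc.mp hi).2
        rw [if_neg (by omega)]
      simp only [this, ← hs, if_true]
      omega
    · intro i hi
      by_cases hi' : i = d + 1
      · simpa [hi'] using hcm
      · have := hlt i ⟨hi.1, by have := hi.2; omega⟩
        simp only [hi', if_false]
        omega

/-- For `d ≥ 1` every `a` has a `d`-th Macaulay representation. -/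
theorem exists_isMacaulayRep {d : ℕ} (hd : 1 ≤ d) (a : ℕ) : ∃ k, IsMacaulayRep d a k := by
  obtain ⟨e, rfl⟩ : ∃ e, d = e + 1 := ⟨d - 1, by omega⟩
  obtain ⟨k, hk, _⟩ := exists_rep_of_lt_choose (lt_choose_add_succ a e)
  exact ⟨k, hk⟩

/-- `macaulayPow d a` is given by the usual formula in terms of the representation of `a`. -/
theorem macaulayPow_eq_sum {d a : ℕ} {k : ℕ → ℕ} (h : IsMacaulayRep d a k) :
    macaulayPow d a = ∑ i ∈ Finset.Icc 1 d, (k i + 1).choose (i + 1) := by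
  induction d generalizing a with
  | zero => simp [macaulayPow]
  | succ d ih =>
    obtain ⟨hk, hs⟩ := h
    rw [Finset.sum_Icc_succ_top (by omega)] at hs
    have hk' : StrictMonoOn k (Set.Icc 1 d) := hk.mono (Set.Icc_subset_Icc_right (by omega))
    have h1 := sum_choose_lt (m := k (d + 1)) hk'
      (fun i hi => hk ⟨hi.1, by have := hi.2; omega⟩ ⟨by omega, le_refl _⟩
        (by have := hi.2; omega))
    have h3 := Nat.choose_succ_succ (k (d + 1)) d
    simp only [Nat.succ_eq_add_one] at h3
    have hle : k (d + 1) ≤ a + d := by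
      by_contra hcon
      have h4 := Nat.choose_le_choose (d + 1) (show a + d + 1 ≤ k (d + 1) by omega)
      have h5 := lt_choose_add_succ a d
      omega
    have hg : Nat.findGreatest (fun k => k.choose (d + 1) ≤ a) (a + d) = k (d + 1) := by
      rw [Nat.findGreatest_eq_iff]
      refine ⟨hle, fun _ => by omega, fun {m} hm _ => ?_⟩
      have := Nat.choose_le_choose (d + 1) (show k (d + 1) + 1 ≤ m by omega)
      omega
    rw [macaulayPow, hg, Finset.sum_Icc_succ_top (by omega),
      ih (a := a - (k (d + 1)).choose (d + 1)) ⟨hk', by omega⟩]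
    exact Nat.add_comm _ _

/-- The differential of a numerical function: `Δ¹(F)(0) = 1`, `Δ¹(F)(q) = F(q) - F(q-1)` for
`q ≥ 1`. Values are taken in `ℤ` since they may be negative. -/
def differential (F : ℕ → ℤ) : ℕ → ℤ
  | 0 => 1
  | q + 1 => F (q + 1) - F q

/-- The `p`-th differential `Δᵖ(H)` of `H`. -/
def iterDifferential (p : ℕ) (H : ℕ → ℕ) : ℕ → ℤ :=
  differential^[p] (fun q => (H q : ℤ))

/-- `F` is a numerical function (that is, takes values in `ℕ`) and satisfies Macaulay's growth
bound `F(q+1) ≤ F(q)^{⟨q⟩}` for all `q ≥ 1`. -/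
def HasMacaulayGrowth (F : ℕ → ℤ) : Prop :=
  (∀ q, 0 ≤ F q) ∧ ∀ q, 1 ≤ q → F (q + 1) ≤ (macaulayPow q (F q).toNat : ℤ)

section

variable (K : Type*) [Field K] (n : ℕ)

attribute [local instance] MvPolynomial.gradedAlgebra

/-- The Hilbert function of `A ⧸ I`, `A = K[x₁, …, xₙ]`: its value at `q` is the `K`-dimension of
the image in `A ⧸ I` of the homogeneous polynomials of degree `q`. -/
noncomputable def quotHilbert (I : Ideal (MvPolynomial (Fin n) K)) (q : ℕ) : ℕ :=
  Module.finrank K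
    ((MvPolynomial.homogeneousSubmodule (Fin n) K q).map (Ideal.Quotient.mkₐ K I).toLinearMap)

/-- The depth of `A ⧸ I`, `A = K[x₁, …, xₙ]`: the supremum of the lengths of the
`A ⧸ I`-regular sequences contained in the ideal `(x₁, …, xₙ)`. -/
noncomputable def quotDepth (I : Ideal (MvPolynomial (Fin n) K)) : ℕ∞ :=
  ⨆ (rs : List (MvPolynomial (Fin n) K))
    (_ : (∀ r ∈ rs, r ∈ MvPolynomial.idealOfVars (Fin n) K) ∧
      RingTheory.Sequence.IsRegular (MvPolynomial (Fin n) K ⧸ I) rs), (rs.length : ℕ∞)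

/-- The set `𝒜_H` of those integers `0 ≤ r ≤ n` for which there is a homogeneous ideal `I` of
`A = K[x₁, …, xₙ]` such that `A ⧸ I` has Hilbert function `H` and depth `r`. -/
def depthSet (H : ℕ → ℕ) : Set ℕ :=
  {r | r ≤ n ∧ ∃ I : Ideal (MvPolynomial (Fin n) K),
    I.IsHomogeneous (MvPolynomial.homogeneousSubmodule (Fin n) K) ∧
      quotHilbert K n I = H ∧ quotDepth K n I = r}

end

/-! Write t^⟨q⟩ for `macaulayPow q t` and t_⟨q⟩ for `greenPow q t`. The theorem combines two
implications with a bound on p.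

Necessity: over an infinite field, a regular sequence of length p in the irrelevant ideal can be
traded for successive regular linear forms (`exists_linear_regularModulo`,
`RegularSequenceModulo.dropLast`). Dividing by a regular linear form replaces the Hilbert function
by its differential, so Δᵖ(H) is itself a Hilbert function and obeys Macaulay's bound. For an
arbitrary K the ideal is first extended to the algebraic closure, which keeps the Hilbert function
and the regular sequence.

Sufficiency: if Δᵖ(H) has Macaulay growth, it counts an order ideal of monomials in H(1) - p ≤ n - p
variables. Adding p free variables gives a monomial ideal on whose quotient these variables form a
regular sequence. A function is determined by its differential and its value at 0, so the quotient
has Hilbert function H.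

As Δᵖ(H)(1) = H(1) - p, the admissible p are bounded. For the largest one the constructed quotient
has depth at least p, and by necessity no quotient with Hilbert function H has larger depth.

Both directions of Macaulay's theorem are needed. For the bound, standard monomials reduce the claim
to order ideals of monomials; compression makes the complement strongly stable without enlarging its
shadow (`exists_isStronglyStable`); then Green's restriction theorem (`card_filter_eq_zero_le`) and
t + (t_⟨q⟩)^⟨q⟩ ≤ t^⟨q⟩ finish by induction on the number of variables. For existence, initial
segments in colexicographic order form an order ideal (`mem_colexSegment_of_add_single_mem`). -/

/-! ### Arithmetic of Macaulay's and Green's operations on binomial representations -/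

/-- The function `a ↦ C(k d - 1, d) + ⋯ + C(k 1 - 1, 1)`, where `k` is the `d`-th Macaulay
representation of `a` (terms with `k i = 0` are omitted), computed greedily. -/
def greenPow : ℕ → ℕ → ℕ
  | 0, _ => 0
  | d + 1, a =>
    (Nat.findGreatest (fun k => k.choose (d + 1) ≤ a) (a + d) - 1).choose (d + 1) +
      greenPow d (a - (Nat.findGreatest (fun k => k.choose (d + 1) ≤ a) (a + d)).choose (d + 1))

/-- By Pascal's rule r < C(k, q) means that the number stays below C(k + 1, q + 1), so the greedy
choice is k. The recursions of `macaulayPow`, `greenPow` and `colexSegment` are all unfolded through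
this step. -/
theorem findGreatest_choose_add {q k r : ℕ} (hr : r < k.choose q) :
    Nat.findGreatest (fun j => j.choose (q + 1) ≤ k.choose (q + 1) + r)
      (k.choose (q + 1) + r + q) = k := by
  have h3 := Nat.choose_succ_succ k q
  simp only [Nat.succ_eq_add_one] at h3
  rw [Nat.findGreatest_eq_iff]
  refine ⟨?_, fun _ => by omega, fun {m} hm _ => ?_⟩
  · by_contra hcon
    have h4 := Nat.choose_le_choose (q + 1) (show k.choose (q + 1) + r + q + 1 ≤ k by omega)
    have h5 := lt_choose_add_succ (k.choose (q + 1) + r) q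
    omega
  · have := Nat.choose_le_choose (q + 1) (show k + 1 ≤ m by omega)
    omega

theorem macaulayPow_choose_add {q k r : ℕ} (hr : r < k.choose q) :
    macaulayPow (q + 1) (k.choose (q + 1) + r) =
      (k + 1).choose (q + 2) + macaulayPow q r := by
  rw [macaulayPow, findGreatest_choose_add hr, Nat.add_sub_cancel_left]

theorem greenPow_choose_add {q k r : ℕ} (hr : r < k.choose q) :
    greenPow (q + 1) (k.choose (q + 1) + r) = (k - 1).choose (q + 1) + greenPow q r := by
  rw [greenPow, findGreatest_choose_add hr, Nat.add_sub_cancel_left]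

theorem exists_eq_choose_add (q t : ℕ) :
    ∃ k r : ℕ, t = k.choose (q + 1) + r ∧ r < k.choose q := by
  set k := Nat.findGreatest (fun k => k.choose (q + 1) ≤ t) (t + q + 1) with hk
  have h1 : k.choose (q + 1) ≤ t :=
    Nat.findGreatest_spec (P := fun k => k.choose (q + 1) ≤ t) (Nat.zero_le _) (by simp)
  have hlt : k < t + q + 1 := by
    by_contra hcon
    have := Nat.choose_le_choose (q + 1) (not_lt.mp hcon)
    have := lt_choose_add_succ t q
    omega
  have h2 : t < (k + 1).choose (q + 1) := by
    have := Nat.findGreatest_is_greatest (P := fun k => k.choose (q + 1) ≤ t)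
      (n := t + q + 1) (k := k + 1) (by omega) (by omega)
    omega
  have h3 := Nat.choose_succ_succ k q
  simp only [Nat.succ_eq_add_one] at h3
  exact ⟨k, t - k.choose (q + 1), by omega, by omega⟩

theorem greenPow_zero_right (q : ℕ) : greenPow q 0 = 0 := by
  induction q with
  | zero => rfl
  | succ q ih =>
    have := greenPow_choose_add (q := q) (k := q) (r := 0) (by simp)
    simpa [ih, Nat.choose_eq_zero_of_lt (show q - 1 < q + 1 by omega)] using this

theorem macaulayPow_zero_right (q : ℕ) : macaulayPow q 0 = 0 := by
  induction q with
  | zero => rfl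
  | succ q ih =>
    have := macaulayPow_choose_add (q := q) (k := q) (r := 0) (by simp)
    simpa [ih] using this

theorem greenPow_choose (q k : ℕ) :
    greenPow (q + 1) (k.choose (q + 1)) = (k - 1).choose (q + 1) := by
  rcases lt_or_ge k q with h | h
  · rw [Nat.choose_eq_zero_of_lt (by omega), Nat.choose_eq_zero_of_lt (by omega),
      greenPow_zero_right]
  · have := greenPow_choose_add (q := q) (k := k) (r := 0) (Nat.choose_pos h)
    simpa [greenPow_zero_right] using this

theorem macaulayPow_choose (q k : ℕ) :
    macaulayPow (q + 1) (k.choose (q + 1)) = (k + 1).choose (q + 2) := by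
  rcases lt_or_ge k q with h | h
  · rw [Nat.choose_eq_zero_of_lt (by omega), Nat.choose_eq_zero_of_lt (by omega),
      macaulayPow_zero_right]
  · have := macaulayPow_choose_add (q := q) (k := k) (r := 0) (Nat.choose_pos h)
    simpa [macaulayPow_zero_right] using this

theorem choose_pred_add {k : ℕ} (hk : 0 < k) (q : ℕ) :
    (k - 1).choose (q + 1) + (k - 1).choose q = k.choose (q + 1) := by
  obtain ⟨j, rfl⟩ : ∃ j, k = j + 1 := ⟨k - 1, by omega⟩
  rw [Nat.add_sub_cancel, Nat.choose_succ_succ' j q, add_comm]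

/-- Adding 1 either changes only the remainder, or the remainder fills up and the number becomes C(k
+ 1, q + 1); Pascal's rule matches the second case with the last step of the remainder. -/
theorem greenPow_succ_bounds (q t : ℕ) :
    greenPow q t ≤ greenPow q (t + 1) ∧ greenPow q (t + 1) ≤ greenPow q t + 1 := by
  induction q generalizing t with
  | zero => simp [greenPow]
  | succ q ih =>
    obtain ⟨k, r, rfl, hr⟩ := exists_eq_choose_add q t
    rcases lt_or_ge (r + 1) (k.choose q) with h | h
    · rw [add_assoc, greenPow_choose_add hr, greenPow_choose_add h]
      have := ih r
      omega
    · have h3 := Nat.choose_succ_succ k q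
      simp only [Nat.succ_eq_add_one] at h3
      have e : k.choose (q + 1) + r + 1 = (k + 1).choose (q + 1) := by omega
      rw [e, greenPow_choose_add hr, greenPow_choose, Nat.add_sub_cancel]
      have h4 := ih r
      rw [show r + 1 = k.choose q by omega] at h4
      rcases Nat.eq_zero_or_pos k with rfl | hk
      · rcases q with _ | q <;> simp_all [greenPow]
      have h5 := choose_pred_add hk q
      -- `greenPow 0` vanishes although C(k - 1, 0) = 1, so q = 0 does not follow the general
      -- pattern.
      rcases q with _ | q
      · simp [greenPow] at h5 ⊢
        omega
      · rw [greenPow_choose] at h4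
        omega

theorem greenPow_mono (q : ℕ) : Monotone (greenPow q) :=
  monotone_nat_of_le_succ fun t => (greenPow_succ_bounds q t).1

theorem greenPow_add_le (q t s : ℕ) : greenPow q (t + s) ≤ greenPow q t + s := by
  induction s with
  | zero => rfl
  | succ s ih => have := (greenPow_succ_bounds q (t + s)).2; rw [← add_assoc]; omega

theorem greenPow_lt {q t : ℕ} (ht : 0 < t) : greenPow q t < t := by
  have h1 := greenPow_add_le q 1 (t - 1)
  rw [show 1 + (t - 1) = t by omega] at h1
  have : greenPow q 1 = 0 := by
    rcases q with _ | q
    · rfl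
    · simpa using greenPow_choose q (q + 1)
  omega

theorem macaulayPow_succ_le (q t : ℕ) : macaulayPow q t ≤ macaulayPow q (t + 1) := by
  induction q generalizing t with
  | zero => simp [macaulayPow]
  | succ q ih =>
    obtain ⟨k, r, rfl, hr⟩ := exists_eq_choose_add q t
    rcases lt_or_ge (r + 1) (k.choose q) with h | h
    · rw [add_assoc, macaulayPow_choose_add hr, macaulayPow_choose_add h]
      have := ih r
      omega
    · have h3 := Nat.choose_succ_succ k q
      simp only [Nat.succ_eq_add_one] at h3
      have e : k.choose (q + 1) + r + 1 = (k + 1).choose (q + 1) := by omega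
      rw [e, macaulayPow_choose_add hr, macaulayPow_choose]
      have h4 := ih r
      rw [show r + 1 = k.choose q by omega] at h4
      have h5 := Nat.choose_succ_succ (k + 1) (q + 1)
      simp only [Nat.succ_eq_add_one] at h5
      rw [h5]
      rcases q with _ | q
      · simp [macaulayPow]
      · rw [macaulayPow_choose] at h4
        simp only [Nat.add_assoc, Nat.reduceAdd] at *
        omega

theorem macaulayPow_mono (q : ℕ) : Monotone (macaulayPow q) :=
  monotone_nat_of_le_succ (macaulayPow_succ_le q)

/-- This is the numerical contradiction in Green's theorem, where c counts the members of a set of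
size t that avoid the last variable. If c reaches the leading coefficient C(k, ·) of t, Pascal's
rule and monotonicity suffice. Otherwise C(k - 1, ·) is split off from c, and the rest is the same
claim for the remainder of t in one degree less. -/
theorem greenPow_add_greenPow_lt (q : ℕ) {c t : ℕ} (hct : c ≤ t) (h : greenPow (q + 1) t < c) :
    greenPow (q + 1) c + greenPow q (t - c) < c := by
  induction q generalizing c t with
  | zero => simpa [greenPow.eq_1] using greenPow_lt (q := 1) (show 0 < c by omega)
  | succ q ih =>
    obtain ⟨k, r, rfl, hr⟩ := exists_eq_choose_add (q + 1) t
    rw [greenPow_choose_add hr] at h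
    have hk : 0 < k := by
      rcases Nat.eq_zero_or_pos k with rfl | hk
      · simp at hr
      · exact hk
    have e1 := choose_pred_add hk (q + 1)
    simp only [Nat.add_assoc, Nat.reduceAdd] at *
    rcases le_or_gt (k.choose (q + 2)) c with hc | hc
    · obtain ⟨c', rfl⟩ := Nat.exists_eq_add_of_le hc
      have hg := greenPow_choose_add (q := q + 1) (k := k) (r := c') (by omega)
      simp only [Nat.add_assoc, Nat.reduceAdd] at *
      rw [hg, show k.choose (q + 2) + r - (k.choose (q + 2) + c') = r - c' by omega]
      rcases Nat.eq_zero_or_pos c' with rfl | hc'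
      · rw [greenPow_zero_right, Nat.sub_zero]
        omega
      · have h1 := greenPow_mono (q + 1) (show r - c' ≤ k.choose (q + 1) by omega)
        rw [greenPow_choose] at h1
        have := greenPow_lt (q := q + 1) hc'
        omega
    · obtain ⟨c', rfl⟩ := Nat.exists_eq_add_of_le (show (k - 1).choose (q + 2) ≤ c by omega)
      have hc' : c' < (k - 1).choose (q + 1) := by omega
      have hk1 : 0 < k - 1 := by
        rcases Nat.eq_zero_or_pos (k - 1) with h0 | h0
        · rw [h0] at hc'; simp at hc'
        · exact h0
      have e2 := choose_pred_add hk1 (q + 1)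
      have e3 := choose_pred_add hk q
      simp only [Nat.add_assoc, Nat.reduceAdd] at *
      have hg := greenPow_choose_add (q := q + 1) (k := k - 1) (r := c') hc'
      simp only [Nat.add_assoc, Nat.reduceAdd] at *
      rw [hg]
      have hlt := greenPow_lt (q := q + 1) (t := c') (by omega)
      rcases le_or_gt c' r with hcr | hcr
      · have h1 := ih hcr (by omega)
        have h2 := greenPow_add_le (q + 1) r (k.choose (q + 1) - r)
        rw [show r + (k.choose (q + 1) - r) = k.choose (q + 1) by omega, greenPow_choose] at h2
        have h3 := greenPow_choose_add (q := q) (k := k - 1) (r := r - c') (by omega)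
        rw [show k.choose (q + 2) + r - ((k - 1).choose (q + 2) + c') =
          (k - 1).choose (q + 1) + (r - c') by omega, h3]
        omega
      · have h1 := greenPow_mono (q + 1)
          (show k.choose (q + 2) + r - ((k - 1).choose (q + 2) + c') ≤ (k - 1).choose (q + 1)
            by omega)
        rw [greenPow_choose] at h1
        omega

/-- Term by term this is C(k + 1, i + 1) = C(k, i) + C(k, i + 1): lowering k and then raising k and
i turns C(k, i) into C(k, i + 1). -/
theorem add_macaulayPow_greenPow_le {q : ℕ} (hq : 1 ≤ q) (t : ℕ) :
    t + macaulayPow q (greenPow q t) ≤ macaulayPow q t := by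
  obtain ⟨q, rfl⟩ := Nat.exists_eq_add_of_le' hq
  clear hq
  induction q generalizing t with
  | zero =>
    have h1 : macaulayPow 1 t = (t + 1).choose 2 := by simpa using macaulayPow_choose 0 t
    have h2 : greenPow 1 t = t - 1 := by simpa using greenPow_choose 0 t
    have h3 : macaulayPow 1 (t - 1) = (t - 1 + 1).choose 2 := by
      simpa using macaulayPow_choose 0 (t - 1)
    rw [zero_add, h1, h2, h3]
    rcases t with _ | t
    · simp
    · rw [Nat.add_sub_cancel, Nat.choose_succ_succ' (t + 1) 1, Nat.choose_one_right]
  | succ q ih =>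
    obtain ⟨k, r, rfl, hr⟩ := exists_eq_choose_add (q + 1) t
    have hk : 0 < k := by
      rcases Nat.eq_zero_or_pos k with rfl | hk
      · simp at hr
      · exact hk
    rw [greenPow_choose_add hr, macaulayPow_choose_add hr]
    have h1 := greenPow_mono (q + 1) hr.le
    rw [greenPow_choose] at h1
    have e1 := Nat.choose_succ_succ' k (q + 2)
    have h2 := ih r
    simp only [Nat.add_assoc, Nat.reduceAdd] at *
    rcases h1.lt_or_eq with h | h
    · have h3 := macaulayPow_choose_add (q := q + 1) h
      rw [Nat.sub_add_cancel hk] at h3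
      simp only [Nat.add_assoc, Nat.reduceAdd] at *
      omega
    -- The lowered representation is not admissible here; it carries, and its value is C(k, q + 2).
    · have e2 := choose_pred_add hk (q + 1)
      rw [h, macaulayPow_choose, Nat.sub_add_cancel hk] at h2
      simp only [Nat.add_assoc, Nat.reduceAdd] at *
      rw [h, e2, macaulayPow_choose (q + 1) k]
      simp only [Nat.add_assoc, Nat.reduceAdd] at *
      omega

/-! ### Monomials and their shadows -/

/-- The exponents of the monomials of degree `q` in the first `n` variables. -/
noncomputable def degreeMonomials (n q : ℕ) : Finset (ℕ →₀ ℕ) :=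
  (Finset.range n).finsuppAntidiag q

theorem mem_degreeMonomials {n q : ℕ} {f : ℕ →₀ ℕ} :
    f ∈ degreeMonomials n q ↔ f.degree = q ∧ ∀ k, n ≤ k → f k = 0 := by
  have h : f.support ⊆ Finset.range n ↔ ∀ k, n ≤ k → f k = 0 := by
    constructor
    · intro h k hk
      by_contra h0
      have := h (Finsupp.mem_support_iff.2 h0)
      rw [Finset.mem_range] at this
      omega
    · intro h k hk
      rw [Finset.mem_range]
      by_contra h0
      exact Finsupp.mem_support_iff.1 hk (h k (by omega))
  rw [degreeMonomials, Finset.mem_finsuppAntidiag, h]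
  constructor
  · rintro ⟨h1, h2⟩
    refine ⟨?_, h2⟩
    rw [← h1, Finsupp.degree_apply]
    exact Finset.sum_subset (h.2 h2) fun k _ hk => Finsupp.notMem_support_iff.1 hk
  · rintro ⟨h1, h2⟩
    refine ⟨?_, h2⟩
    rw [← h1, Finsupp.degree_apply]
    exact (Finset.sum_subset (h.2 h2) fun k _ hk => Finsupp.notMem_support_iff.1 hk).symm

theorem Finsupp.degree_add_single (f : ℕ →₀ ℕ) (k : ℕ) :
    (f + Finsupp.single k 1).degree = f.degree + 1 := by
  rw [map_add, Finsupp.degree_single]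

/-- The multiples `x_k m`, `k < n`, of the monomials `m` in `W`. -/
noncomputable def upperShadow (n : ℕ) (W : Finset (ℕ →₀ ℕ)) : Finset (ℕ →₀ ℕ) :=
  (Finset.range n).biUnion fun k => W.image (· + Finsupp.single k 1)

theorem mem_upperShadow {n : ℕ} {W : Finset (ℕ →₀ ℕ)} {f : ℕ →₀ ℕ} :
    f ∈ upperShadow n W ↔ ∃ k < n, ∃ g ∈ W, g + Finsupp.single k 1 = f := by
  simp [upperShadow]

theorem upperShadow_subset {n q : ℕ} {W : Finset (ℕ →₀ ℕ)} (hW : W ⊆ degreeMonomials n q) :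
    upperShadow n W ⊆ degreeMonomials n (q + 1) := by
  intro f hf
  obtain ⟨k, hk, g, hg, rfl⟩ := mem_upperShadow.1 hf
  have := mem_degreeMonomials.1 (hW hg)
  rw [mem_degreeMonomials, Finsupp.degree_add_single, this.1]
  refine ⟨rfl, fun l hl => ?_⟩
  rw [Finsupp.add_apply, this.2 l hl, Finsupp.single_eq_of_ne (by omega), add_zero]

/-! ### Compression to strongly stable sets -/

/-- Replace every factor `x_j` of a monomial by `x_i`. -/
noncomputable def mergeVar (i j : ℕ) (f : ℕ →₀ ℕ) : ℕ →₀ ℕ :=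
  f.erase j + Finsupp.single i (f j)

section Merge

variable {i j : ℕ}

theorem mergeVar_add_single (f : ℕ →₀ ℕ) :
    mergeVar i j f + Finsupp.single j (f j) = f + Finsupp.single i (f j) := by
  rw [mergeVar, add_right_comm, Finsupp.erase_add_single]

theorem mergeVar_apply_of_ne {f : ℕ →₀ ℕ} {k : ℕ} (hi : k ≠ i) (hj : k ≠ j) :
    mergeVar i j f k = f k := by
  simp [mergeVar, Finsupp.erase_ne hj, Finsupp.single_eq_of_ne hi]

theorem mergeVar_apply_left (hij : i ≠ j) (f : ℕ →₀ ℕ) : mergeVar i j f i = f i + f j := by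
  simp [mergeVar, Finsupp.erase_ne hij]

theorem mergeVar_apply_right (hij : i ≠ j) (f : ℕ →₀ ℕ) : mergeVar i j f j = 0 := by
  simp [mergeVar, Finsupp.single_eq_of_ne hij.symm]

theorem mergeVar_eq_iff (hij : i ≠ j) {f g : ℕ →₀ ℕ} : mergeVar i j f = mergeVar i j g ↔
    (∀ k, k ≠ i → k ≠ j → f k = g k) ∧ f i + f j = g i + g j := by
  constructor
  · intro h
    refine ⟨fun k hi hj => ?_, ?_⟩
    · have := DFunLike.congr_fun h k
      rwa [mergeVar_apply_of_ne hi hj, mergeVar_apply_of_ne hi hj] at this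
    · have := DFunLike.congr_fun h i
      rwa [mergeVar_apply_left hij, mergeVar_apply_left hij] at this
  · rintro ⟨h1, h2⟩
    ext k
    rcases eq_or_ne k i with rfl | hi
    · rwa [mergeVar_apply_left hij, mergeVar_apply_left hij]
    rcases eq_or_ne k j with rfl | hj
    · rw [mergeVar_apply_right hij, mergeVar_apply_right hij]
    · rw [mergeVar_apply_of_ne hi hj, mergeVar_apply_of_ne hi hj, h1 k hi hj]

/-- A fibre of `mergeVar` is a chain parametrised by the exponent of x_j; by `exists_mergeVar_eq`
this exponent takes every value up to the joint exponent of x_i and x_j. -/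
theorem eq_of_mergeVar_eq (hij : i ≠ j) {f g : ℕ →₀ ℕ} (h : mergeVar i j f = mergeVar i j g)
    (hj : f j = g j) : f = g := by
  have := (mergeVar_eq_iff hij).1 h
  ext k
  rcases eq_or_ne k i with rfl | hi
  · omega
  rcases eq_or_ne k j with rfl | hj'
  · exact hj
  · exact this.1 k hi hj'

theorem exists_mergeVar_eq (hij : i ≠ j) (f : ℕ →₀ ℕ) {t : ℕ} (ht : t ≤ f i + f j) :
    ∃ g, mergeVar i j g = mergeVar i j f ∧ g j = t := by
  refine ⟨(f.erase i).erase j + Finsupp.single i (f i + f j - t) + Finsupp.single j t, ?_, ?_⟩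
  · rw [mergeVar_eq_iff hij]
    refine ⟨fun k hi hj => ?_, ?_⟩
    · simp [Finsupp.erase_ne hi, Finsupp.erase_ne hj, Finsupp.single_eq_of_ne hi,
        Finsupp.single_eq_of_ne hj]
    · simp [Finsupp.single_eq_of_ne hij, Finsupp.single_eq_of_ne hij.symm, Finsupp.erase_ne hij]
      omega
  · simp [Finsupp.single_eq_of_ne hij.symm]

theorem mem_degreeMonomials_of_mergeVar_eq {n q : ℕ} (hij : i < j) (hj : j < n) {f g : ℕ →₀ ℕ}
    (h : mergeVar i j g = mergeVar i j f) (hf : f ∈ degreeMonomials n q) :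
    g ∈ degreeMonomials n q := by
  rw [mem_degreeMonomials] at hf ⊢
  have hdeg : ∀ u : ℕ →₀ ℕ, (mergeVar i j u).degree = u.degree := fun u => by
    have := congrArg Finsupp.degree (mergeVar_add_single (i := i) (j := j) u)
    rw [map_add, map_add, Finsupp.degree_single, Finsupp.degree_single] at this
    omega
  refine ⟨by rw [← hdeg g, h, hdeg, hf.1], fun k hk => ?_⟩
  rw [((mergeVar_eq_iff hij.ne).1 h).1 k (by omega) (by omega), hf.2 k hk]

/-- The members of `W` which agree with `f` up to exchanging `x_i` and `x_j`. -/
noncomputable def mergeFiber (i j : ℕ) (W : Finset (ℕ →₀ ℕ)) (p : ℕ →₀ ℕ) : Finset (ℕ →₀ ℕ) :=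
  W.filter fun g => mergeVar i j g = p

theorem mem_mergeFiber {W : Finset (ℕ →₀ ℕ)} {p g : ℕ →₀ ℕ} :
    g ∈ mergeFiber i j W p ↔ g ∈ W ∧ mergeVar i j g = p := Finset.mem_filter

/-- In every set of monomials that agree up to exchanging `x_i` and `x_j`, replace the members
of `W` by as many members with the smallest exponents of `x_j`. -/
noncomputable def compressVar (n q i j : ℕ) (W : Finset (ℕ →₀ ℕ)) : Finset (ℕ →₀ ℕ) :=
  (degreeMonomials n q).filter fun f => f j < (mergeFiber i j W (mergeVar i j f)).card

variable {n q : ℕ} {W : Finset (ℕ →₀ ℕ)}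

theorem mem_compressVar {f : ℕ →₀ ℕ} : f ∈ compressVar n q i j W ↔
    f ∈ degreeMonomials n q ∧ f j < (mergeFiber i j W (mergeVar i j f)).card := Finset.mem_filter

/-- The exponents of x_j in the compressed fibre are exactly 0, 1, … up to the old cardinality minus
one; they all occur because the old fibre fits into its chain. -/
theorem card_mergeFiber_compressVar (hij : i < j) (hj : j < n) (hW : W ⊆ degreeMonomials n q)
    (p : ℕ →₀ ℕ) :
    (mergeFiber i j (compressVar n q i j W) p).card = (mergeFiber i j W p).card := by
  have hinj : ∀ V : Finset (ℕ →₀ ℕ), Set.InjOn (fun f : ℕ →₀ ℕ => f j) (mergeFiber i j V p) := by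
    intro V f hf g hg h
    rw [SetLike.mem_coe, mem_mergeFiber] at hf hg
    exact eq_of_mergeVar_eq hij.ne (hf.2.trans hg.2.symm) h
  rw [← Finset.card_image_of_injOn (hinj _)]
  suffices h : (mergeFiber i j (compressVar n q i j W) p).image (fun f => f j) =
      Finset.range (mergeFiber i j W p).card by rw [h, Finset.card_range]
  ext t
  rw [Finset.mem_image, Finset.mem_range]
  constructor
  · rintro ⟨f, hf, rfl⟩
    obtain ⟨hf, hfp⟩ := mem_mergeFiber.1 hf
    have := (mem_compressVar.1 hf).2
    rwa [hfp] at this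
  · intro ht
    obtain ⟨f, hf⟩ := Finset.card_pos.1 (by omega : 0 < (mergeFiber i j W p).card)
    have hle : (mergeFiber i j W p).card ≤ f i + f j + 1 := by
      rw [← Finset.card_image_of_injOn (hinj _)]
      refine (Finset.card_le_card (t := Finset.range (f i + f j + 1)) ?_).trans
        (Finset.card_range _).le
      intro t ht
      obtain ⟨g, hg, rfl⟩ := Finset.mem_image.1 ht
      have := ((mergeVar_eq_iff hij.ne).1
        ((mem_mergeFiber.1 hg).2.trans (mem_mergeFiber.1 hf).2.symm)).2
      rw [Finset.mem_range]
      omega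
    obtain ⟨hfW, rfl⟩ := mem_mergeFiber.1 hf
    obtain ⟨g, hg, rfl⟩ := exists_mergeVar_eq hij.ne f (show t ≤ f i + f j by omega)
    refine ⟨g, mem_mergeFiber.2 ⟨mem_compressVar.2
      ⟨mem_degreeMonomials_of_mergeVar_eq hij hj hg (hW hfW), ?_⟩, hg⟩, rfl⟩
    rwa [hg]

theorem card_eq_sum_card_mergeFiber {V : Finset (ℕ →₀ ℕ)} (hV : V ⊆ degreeMonomials n q) :
    V.card = ∑ p ∈ (degreeMonomials n q).image (mergeVar i j), (mergeFiber i j V p).card :=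
  Finset.card_eq_sum_card_fiberwise fun _ hf => Finset.mem_coe.2 (Finset.mem_image_of_mem _ (hV hf))

theorem compressVar_subset : compressVar n q i j W ⊆ degreeMonomials n q := Finset.filter_subset _ _

theorem card_compressVar (hij : i < j) (hj : j < n) (hW : W ⊆ degreeMonomials n q) :
    (compressVar n q i j W).card = W.card := by
  rw [card_eq_sum_card_mergeFiber (i := i) (j := j) compressVar_subset,
    card_eq_sum_card_mergeFiber (i := i) (j := j) hW]
  exact Finset.sum_congr rfl fun p _ => card_mergeFiber_compressVar hij hj hW p

/-- Multiplying a nonempty fibre by x_i and x_j yields at least one more member than the fibre has,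
and multiplying by another variable loses none. This is all the room that the shadow of the
compressed fibre needs. -/
theorem upperShadow_compressVar_subset (hij : i < j) (hj : j < n) :
    upperShadow n (compressVar n q i j W) ⊆ compressVar n (q + 1) i j (upperShadow n W) := by
  intro f hf
  rw [mem_compressVar]
  refine ⟨upperShadow_subset compressVar_subset hf, ?_⟩
  obtain ⟨k, hk, g, hg, rfl⟩ := mem_upperShadow.1 hf
  have hlt := (mem_compressVar.1 hg).2
  have hmem : ∀ l < n, (∀ m, m ≠ i → m ≠ j →
        (Finsupp.single l 1 : ℕ →₀ ℕ) m = (Finsupp.single k 1 : ℕ →₀ ℕ) m) →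
      (Finsupp.single l 1 : ℕ →₀ ℕ) i + (Finsupp.single l 1 : ℕ →₀ ℕ) j =
        (Finsupp.single k 1 : ℕ →₀ ℕ) i + (Finsupp.single k 1 : ℕ →₀ ℕ) j →
      ∀ u ∈ mergeFiber i j W (mergeVar i j g), u + Finsupp.single l 1 ∈
        mergeFiber i j (upperShadow n W) (mergeVar i j (g + Finsupp.single k 1)) := by
    intro l hl h1 h2 u hu
    obtain ⟨hu, hug⟩ := mem_mergeFiber.1 hu
    rw [mergeVar_eq_iff hij.ne] at hug
    rw [mem_mergeFiber, mergeVar_eq_iff hij.ne]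
    refine ⟨mem_upperShadow.2 ⟨l, hl, u, hu, rfl⟩, fun m hi hj => ?_, ?_⟩
    · rw [Finsupp.add_apply, Finsupp.add_apply, hug.1 m hi hj, h1 m hi hj]
    · simp only [Finsupp.add_apply]
      omega
  have hcard : ∀ l : ℕ, ((mergeFiber i j W (mergeVar i j g)).image
      (· + Finsupp.single l 1)).card = (mergeFiber i j W (mergeVar i j g)).card := fun l =>
    Finset.card_image_of_injective _ (add_left_injective _)
  by_cases hkij : k = i ∨ k = j
  · have key : (mergeFiber i j W (mergeVar i j g)).card + 1 ≤
        (mergeFiber i j (upperShadow n W) (mergeVar i j (g + Finsupp.single k 1))).card := by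
      obtain ⟨u, hu, hmax⟩ := Finset.exists_max_image (mergeFiber i j W (mergeVar i j g))
        (fun u => u j) (Finset.card_pos.1 (by omega))
      -- The extra member is x_j u for u with the largest exponent of x_j: that exponent is too
      -- large for a product of x_i with a member of the fibre.
      have hnot : u + Finsupp.single j 1 ∉ (mergeFiber i j W (mergeVar i j g)).image
          (· + Finsupp.single i 1) := by
        intro h
        obtain ⟨v, hv, hvu⟩ := Finset.mem_image.1 h
        have h1 := hmax v hv
        have h2 := DFunLike.congr_fun hvu j
        simp [Finsupp.single_eq_of_ne hij.ne'] at h2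
        omega
      rw [← hcard i, ← Finset.card_insert_of_notMem hnot]
      refine Finset.card_le_card (Finset.insert_subset ?_ ?_)
      · refine hmem j hj ?_ ?_ u hu
        · intro m hi hj
          rcases hkij with rfl | rfl
          · rw [Finsupp.single_eq_of_ne hi, Finsupp.single_eq_of_ne hj]
          · rfl
        · rcases hkij with rfl | rfl
          · simp [Finsupp.single_eq_of_ne hij.ne, Finsupp.single_eq_of_ne hij.ne']
          · rfl
      · intro v hv
        obtain ⟨u, hu, rfl⟩ := Finset.mem_image.1 hv
        refine hmem i (hij.trans hj) ?_ ?_ u hu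
        · intro m hi hj
          rcases hkij with rfl | rfl
          · rfl
          · rw [Finsupp.single_eq_of_ne hi, Finsupp.single_eq_of_ne hj]
        · rcases hkij with rfl | rfl
          · rfl
          · simp [Finsupp.single_eq_of_ne hij.ne, Finsupp.single_eq_of_ne hij.ne']
    have : (Finsupp.single k 1 : ℕ →₀ ℕ) j ≤ 1 := by
      rw [Finsupp.single_apply]; split_ifs <;> omega
    rw [Finsupp.add_apply]
    omega
  · push Not at hkij
    rw [Finsupp.add_apply, Finsupp.single_eq_of_ne hkij.2.symm, add_zero]
    refine hlt.trans_le ?_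
    rw [← hcard k]
    refine Finset.card_le_card fun v hv => ?_
    obtain ⟨u, hu, rfl⟩ := Finset.mem_image.1 hv
    exact hmem k hk (fun _ _ _ => rfl) rfl u hu

theorem card_upperShadow_compressVar_le (hij : i < j) (hj : j < n)
    (hW : W ⊆ degreeMonomials n q) :
    (upperShadow n (compressVar n q i j W)).card ≤ (upperShadow n W).card :=
  (Finset.card_le_card (upperShadow_compressVar_subset hij hj)).trans
    (card_compressVar hij hj (upperShadow_subset hW)).le

/-- The sum of the indices of the variables of a monomial, with multiplicities. -/
noncomputable def indexWeight : (ℕ →₀ ℕ) →+ ℕ :=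
  Finsupp.liftAddHom fun k => AddMonoidHom.mulLeft k

theorem indexWeight_single (k a : ℕ) : indexWeight (Finsupp.single k a) = k * a := by
  simp [indexWeight]

theorem indexWeight_lt (hij : i < j) {f g : ℕ →₀ ℕ} (h : mergeVar i j f = mergeVar i j g)
    (hlt : f j < g j) : indexWeight f < indexWeight g := by
  have hf := congrArg indexWeight (mergeVar_add_single (i := i) (j := j) f)
  have hg := congrArg indexWeight (mergeVar_add_single (i := i) (j := j) g)
  rw [map_add, map_add, indexWeight_single, indexWeight_single] at hf hg
  rw [h] at hf
  nlinarith

/-- In each fibre as many members are gained as lost, and each gained one has a smaller exponent of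
x_j than each lost one. Hence repeated compression terminates. -/
theorem sum_indexWeight_compressVar_lt (hij : i < j) (hj : j < n)
    (hW : W ⊆ degreeMonomials n q) (hne : compressVar n q i j W ≠ W) :
    ∑ f ∈ compressVar n q i j W, indexWeight f < ∑ f ∈ W, indexWeight f := by
  set C := compressVar n q i j W with hC
  have hcard : ∀ p, (mergeFiber i j (C \ W) p).card = (mergeFiber i j (W \ C) p).card := by
    intro p
    have h := card_mergeFiber_compressVar hij hj hW p
    have e : ∀ A B : Finset (ℕ →₀ ℕ),
        mergeFiber i j (A \ B) p = mergeFiber i j A p \ mergeFiber i j B p := by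
      intro A B; ext f; simp only [mem_mergeFiber, Finset.mem_sdiff]; tauto
    rw [e, e]
    exact Finset.card_sdiff_comm h
  have hmaps : ∀ V ⊆ degreeMonomials n q, ∀ f ∈ V,
      mergeVar i j f ∈ (degreeMonomials n q).image (mergeVar i j) :=
    fun V hV f hf => Finset.mem_image_of_mem _ (hV hf)
  have h1 : C \ W ⊆ degreeMonomials n q := Finset.sdiff_subset.trans compressVar_subset
  have h2 : W \ C ⊆ degreeMonomials n q := Finset.sdiff_subset.trans hW
  have hfib : ∀ p, ∑ f ∈ mergeFiber i j (C \ W) p, indexWeight f +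
      (mergeFiber i j (C \ W) p).card ≤ ∑ f ∈ mergeFiber i j (W \ C) p, indexWeight f := by
    intro p
    rcases (mergeFiber i j (C \ W) p).eq_empty_or_nonempty with h0 | h0
    · simp [h0]
    obtain ⟨f, hf, hmax⟩ := Finset.exists_max_image _ indexWeight h0
    have ha : ∑ g ∈ mergeFiber i j (C \ W) p, indexWeight g ≤ _ :=
      Finset.sum_le_card_nsmul _ _ _ hmax
    have hb : (mergeFiber i j (W \ C) p).card • (indexWeight f + 1) ≤
        ∑ g ∈ mergeFiber i j (W \ C) p, indexWeight g := by
      refine Finset.card_nsmul_le_sum _ _ _ fun g hg => ?_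
      obtain ⟨hf, hfp⟩ := mem_mergeFiber.1 hf
      obtain ⟨hg, hgp⟩ := mem_mergeFiber.1 hg
      refine indexWeight_lt hij (hfp.trans hgp.symm) ?_
      have hf' := (mem_compressVar.1 (Finset.mem_sdiff.1 hf).1).2
      have hg' := (Finset.mem_sdiff.1 hg).2
      rw [hC, mem_compressVar, not_and, not_lt] at hg'
      have := hg' (h2 hg)
      rw [hgp] at this
      rw [hfp] at hf'
      omega
    rw [← hcard p, smul_add, smul_eq_mul, smul_eq_mul, mul_one] at hb
    rw [smul_eq_mul] at ha
    omega
  have hsum := Finset.sum_le_sum fun p (_ : p ∈ (degreeMonomials n q).image (mergeVar i j)) =>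
    hfib p
  rw [Finset.sum_add_distrib, ← card_eq_sum_card_mergeFiber h1] at hsum
  unfold mergeFiber at hsum
  rw [Finset.sum_fiberwise_of_maps_to (hmaps _ h1),
    Finset.sum_fiberwise_of_maps_to (hmaps _ h2)] at hsum
  have hpos : 0 < (C \ W).card := by
    rw [Finset.card_pos, Finset.sdiff_nonempty]
    intro hsub
    exact hne (Finset.eq_of_subset_of_card_le hsub (card_compressVar hij hj hW).ge)
  rw [← Finset.sum_inter_add_sum_sdiff C W, ← Finset.sum_inter_add_sum_sdiff W C,
    Finset.inter_comm W C]
  omega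

end Merge

/-- `W` is strongly stable: closed under replacing a variable by one of smaller index. -/
def IsStronglyStable (n : ℕ) (W : Finset (ℕ →₀ ℕ)) : Prop :=
  ∀ i j, i < j → j < n → ∀ f, f + Finsupp.single j 1 ∈ W → f + Finsupp.single i 1 ∈ W

/-- Compress as long as something changes; the total `indexWeight` decreases each time. A set fixed
by all compressions is strongly stable. -/
theorem exists_isStronglyStable {n q : ℕ} {W : Finset (ℕ →₀ ℕ)} (hW : W ⊆ degreeMonomials n q) :
    ∃ V ⊆ degreeMonomials n q, V.card = W.card ∧
      (upperShadow n V).card ≤ (upperShadow n W).card ∧ IsStronglyStable n V := by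
  induction hw : ∑ f ∈ W, indexWeight f using Nat.strong_induction_on generalizing W with
  | _ w ih =>
    by_cases h : ∀ i j, i < j → j < n → compressVar n q i j W = W
    · refine ⟨W, hW, rfl, le_rfl, fun i j hij hj f hf => ?_⟩
      have hm : mergeVar i j (f + Finsupp.single i 1) = mergeVar i j (f + Finsupp.single j 1) := by
        rw [mergeVar_eq_iff hij.ne]
        refine ⟨fun k hi hj => ?_, ?_⟩
        · simp [Finsupp.single_eq_of_ne hi, Finsupp.single_eq_of_ne hj]
        · simp [Finsupp.single_eq_of_ne hij.ne, Finsupp.single_eq_of_ne hij.ne']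
          omega
      rw [← h i j hij hj, mem_compressVar] at hf ⊢
      refine ⟨mem_degreeMonomials_of_mergeVar_eq hij hj hm hf.1, ?_⟩
      rw [hm]
      refine lt_of_le_of_lt ?_ hf.2
      simp [Finsupp.single_eq_of_ne hij.ne']
    · push Not at h
      obtain ⟨i, j, hij, hj, hne⟩ := h
      obtain ⟨V, hV, h1, h2, h3⟩ := ih _ (hw ▸ sum_indexWeight_compressVar_lt hij hj hW hne)
        (compressVar_subset) rfl
      exact ⟨V, hV, h1.trans (card_compressVar hij hj hW),
        h2.trans (card_upperShadow_compressVar_le hij hj hW), h3⟩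

/-! ### Green's restriction theorem and Macaulay's bound for monomials -/

theorem add_single_mem_degreeMonomials {n q k : ℕ} {f : ℕ →₀ ℕ} :
    f + Finsupp.single k 1 ∈ degreeMonomials n (q + 1) ↔ f ∈ degreeMonomials n q ∧ k < n := by
  rw [mem_degreeMonomials, mem_degreeMonomials, Finsupp.degree_add_single]
  constructor
  · rintro ⟨h1, h2⟩
    refine ⟨⟨by omega, fun l hl => ?_⟩, ?_⟩
    · have := h2 l hl
      rw [Finsupp.add_apply] at this
      omega
    · by_contra hk
      have := h2 k (by omega)
      simp at this
  · rintro ⟨⟨h1, h2⟩, hk⟩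
    refine ⟨by omega, fun l hl => ?_⟩
    rw [Finsupp.add_apply, h2 l hl, Finsupp.single_eq_of_ne (by omega), add_zero]

theorem Finsupp.exists_eq_add_single {σ : Type*} {f : σ →₀ ℕ} {k : σ} (h : f k ≠ 0) :
    ∃ g, f = g + Finsupp.single k 1 :=
  ⟨f - Finsupp.single k 1, (tsub_add_cancel_of_le (Finsupp.single_le_iff.2 (by omega))).symm⟩

theorem exists_ne_zero_of_mem_degreeMonomials {n q : ℕ} {f : ℕ →₀ ℕ}
    (hf : f ∈ degreeMonomials n (q + 1)) : ∃ k < n, f k ≠ 0 := by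
  rw [mem_degreeMonomials] at hf
  by_contra! h
  have : f = 0 := by
    ext k
    rcases lt_or_ge k n with hk | hk
    · exact h k hk
    · exact hf.2 k hk
  rw [this] at hf
  simp at hf

theorem degreeMonomials_zero_left (q : ℕ) : degreeMonomials 0 (q + 1) = ∅ := by
  rw [Finset.eq_empty_iff_forall_notMem]
  intro f hf
  obtain ⟨k, hk, _⟩ := exists_ne_zero_of_mem_degreeMonomials hf
  omega

theorem filter_subset_degreeMonomials {n q : ℕ} {T : Finset (ℕ →₀ ℕ)}
    (hT : T ⊆ degreeMonomials (n + 1) q) : T.filter (fun f => f n = 0) ⊆ degreeMonomials n q := by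
  intro f hf
  rw [Finset.mem_filter] at hf
  have := mem_degreeMonomials.1 (hT hf.1)
  refine mem_degreeMonomials.2 ⟨this.1, fun k hk => ?_⟩
  rcases hk.eq_or_lt with rfl | hk
  · exact hf.2
  · exact this.2 k hk

/-- `T` is closed under replacing a variable by one of larger index. -/
def IsCostable (n : ℕ) (T : Finset (ℕ →₀ ℕ)) : Prop :=
  ∀ i j, i < j → j < n → ∀ f, f + Finsupp.single i 1 ∈ T → f + Finsupp.single j 1 ∈ T

theorem IsCostable.filter {n : ℕ} {T : Finset (ℕ →₀ ℕ)} (hT : IsCostable (n + 1) T) :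
    IsCostable n (T.filter fun f => f n = 0) := by
  intro i j hij hj f hf
  rw [Finset.mem_filter] at hf ⊢
  refine ⟨hT i j hij (by omega) f hf.1, ?_⟩
  have := hf.2
  rw [Finsupp.add_apply] at this ⊢
  rw [Finsupp.single_eq_of_ne (by omega)]
  omega

theorem card_filter_ne_zero_le {T S : Finset (ℕ →₀ ℕ)} {n : ℕ}
    (h : ∀ f, f + Finsupp.single n 1 ∈ S → f ∈ T) :
    (S.filter fun f => f n ≠ 0).card ≤ T.card := by
  refine (Finset.card_le_card (t := T.image (· + Finsupp.single n 1)) fun f hf => ?_).trans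
    Finset.card_image_le
  obtain ⟨hf, h0⟩ := Finset.mem_filter.1 hf
  obtain ⟨g, rfl⟩ := Finsupp.exists_eq_add_single h0
  exact Finset.mem_image.2 ⟨g, h g hf, rfl⟩

/-- Green's restriction theorem for strongly stable monomial ideals. -/
theorem card_filter_eq_zero_le {n q : ℕ} {T : Finset (ℕ →₀ ℕ)}
    (hT : T ⊆ degreeMonomials (n + 1) (q + 1)) (hs : IsCostable (n + 1) T) :
    (T.filter fun f => f n = 0).card ≤ greenPow (q + 1) T.card := by
  induction n generalizing q T with
  | zero =>
    have := filter_subset_degreeMonomials hT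
    rw [degreeMonomials_zero_left, Finset.subset_empty] at this
    simp [this]
  | succ n ihn =>
    induction q generalizing T with
    | zero =>
      have hg : greenPow (0 + 1) T.card = T.card - 1 := by simpa using greenPow_choose 0 T.card
      rw [hg]
      rcases T.eq_empty_or_nonempty with rfl | ⟨f, hf⟩
      · simp
      -- In degree one, a nonempty costable set contains the last variable, which the filter
      -- removes.
      obtain ⟨k, hk, hfk⟩ := exists_ne_zero_of_mem_degreeMonomials (hT hf)
      obtain ⟨g, rfl⟩ := Finsupp.exists_eq_add_single hfk
      have hg : g + Finsupp.single (n + 1) 1 ∈ T := by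
        rcases (Nat.lt_succ_iff.1 hk).eq_or_lt with rfl | hk
        · exact hf
        · exact hs k (n + 1) hk (by omega) g hf
      have : T.filter (fun f => f (n + 1) = 0) ⊂ T := by
        refine Finset.filter_ssubset.2 ⟨_, hg, ?_⟩
        simp
      have := Finset.card_lt_card this
      omega
    | succ q ihq =>
      set T' := T.filter fun f => f (n + 1) = 0 with hT'
      -- T₁ consists of the quotients by the last variable of the members of T outside T'.
      set T₁ := (degreeMonomials (n + 2) (q + 1)).filter
        fun f => f + Finsupp.single (n + 1) 1 ∈ T with hT₁
      have h1 := ihn (filter_subset_degreeMonomials hT) hs.filter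
      have hs₁ : IsCostable (n + 2) T₁ := by
        intro i j hij hj f hf
        rw [hT₁, Finset.mem_filter, add_right_comm] at hf ⊢
        refine ⟨?_, hs i j hij hj _ hf.2⟩
        have := (add_single_mem_degreeMonomials.1 hf.1).1
        exact add_single_mem_degreeMonomials.2 ⟨this, hj⟩
      have h2 := ihq (T := T₁) (Finset.filter_subset _ _) hs₁
      have hcard : T'.card + T₁.card = T.card := by
        rw [← Finset.card_filter_add_card_filter_not (s := T) fun f => f (n + 1) = 0]
        congr 1
        rw [← Finset.card_image_of_injective T₁ (add_left_injective (Finsupp.single (n + 1) 1))]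
        congr 1
        ext f
        rw [Finset.mem_image, Finset.mem_filter]
        constructor
        · rintro ⟨g, hg, rfl⟩
          exact ⟨(Finset.mem_filter.1 hg).2, by simp⟩
        · rintro ⟨hf, h0⟩
          obtain ⟨g, rfl⟩ := Finsupp.exists_eq_add_single h0
          exact ⟨g, Finset.mem_filter.2 ⟨(add_single_mem_degreeMonomials.1 (hT hf)).1, hf⟩, rfl⟩
      -- Costability allows a factor x_n to be traded for the last variable, so dividing by x_n
      -- leads into T₁, and the last variable remains absent.
      have h3 : (T'.filter fun f => f n ≠ 0).card ≤
          (T₁.filter fun f => f (n + 1) = 0).card := by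
        refine card_filter_ne_zero_le fun f hf => ?_
        obtain ⟨hf, h0⟩ := Finset.mem_filter.1 hf
        rw [Finsupp.add_apply] at h0
        rw [Finset.mem_filter, hT₁, Finset.mem_filter]
        exact ⟨⟨(add_single_mem_degreeMonomials.1 (hT hf)).1,
          hs n (n + 1) (by omega) (by omega) f hf⟩, by omega⟩
      have h4 := Finset.card_filter_add_card_filter_not (s := T') fun f => f n = 0
      change _ + (T'.filter fun f => f n ≠ 0).card = _ at h4
      rw [← hT'] at h1
      -- The two induction hypotheses give |T'| ≤ |T'|_⟨q+2⟩ + |T₁|_⟨q+1⟩, which is impossible if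
      -- |T'| exceeds |T|_⟨q+2⟩.
      by_contra hlt
      have h5 := greenPow_add_greenPow_lt (q + 1) (c := T'.card) (t := T.card) (by omega)
        (by omega)
      rw [show T.card - T'.card = T₁.card by omega] at h5
      omega

/-- Members of S divisible by the last variable inject into T. The others are bounded by induction
from the part of T without that variable, whose size Green's theorem controls;
`add_macaulayPow_greenPow_le` adds the two estimates. -/
theorem card_le_macaulayPow_of_isCostable {n q : ℕ} {T S : Finset (ℕ →₀ ℕ)}
    (hT : T ⊆ degreeMonomials n (q + 1)) (hs : IsCostable n T)
    (hS : S ⊆ degreeMonomials n (q + 2)) (h : ∀ f k, f + Finsupp.single k 1 ∈ S → f ∈ T) :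
    S.card ≤ macaulayPow (q + 1) T.card := by
  induction n generalizing T S with
  | zero =>
    rw [degreeMonomials_zero_left, Finset.subset_empty] at hS
    simp [hS]
  | succ n ih =>
    have h1 := ih (filter_subset_degreeMonomials hT) hs.filter (filter_subset_degreeMonomials hS)
      fun f k hf => by
        obtain ⟨hf, h0⟩ := Finset.mem_filter.1 hf
        rw [Finsupp.add_apply] at h0
        exact Finset.mem_filter.2 ⟨h f k hf, by omega⟩
    have h2 := macaulayPow_mono (q + 1) (card_filter_eq_zero_le hT hs)
    have h3 := card_filter_ne_zero_le (n := n) fun f hf => h f n hf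
    have h4 := Finset.card_filter_add_card_filter_not (s := S) fun f => f n = 0
    change _ + (S.filter fun f => f n ≠ 0).card = _ at h4
    have h5 := add_macaulayPow_greenPow_le (q := q + 1) (by omega) T.card
    omega

/-- **Macaulay's theorem** for order ideals of monomials. -/
theorem card_le_macaulayPow {n q : ℕ} (hq : 1 ≤ q) {T S : Finset (ℕ →₀ ℕ)}
    (hT : T ⊆ degreeMonomials n q) (hS : S ⊆ degreeMonomials n (q + 1))
    (h : ∀ f k, f + Finsupp.single k 1 ∈ S → f ∈ T) : S.card ≤ macaulayPow q T.card := by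
  obtain ⟨q, rfl⟩ := Nat.exists_eq_add_of_le' hq
  -- Compression is applied to the complement of T. The complement of V then has the size of T, and
  -- the complement of the shadow of V is at least as large as S.
  obtain ⟨V, hV, hc, hsh, hst⟩ := exists_isStronglyStable
    (Finset.sdiff_subset (s := degreeMonomials n (q + 1)) (t := T))
  have hcost : IsCostable n (degreeMonomials n (q + 1) \ V) := by
    intro i j hij hj f hf
    rw [Finset.mem_sdiff] at hf ⊢
    exact ⟨add_single_mem_degreeMonomials.2 ⟨(add_single_mem_degreeMonomials.1 hf.1).1, hj⟩,
      fun hV => hf.2 (hst i j hij hj f hV)⟩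
  have h1 := card_le_macaulayPow_of_isCostable Finset.sdiff_subset hcost
    (S := degreeMonomials n (q + 2) \ upperShadow n V) Finset.sdiff_subset fun f k hf => by
      rw [Finset.mem_sdiff] at hf ⊢
      have := add_single_mem_degreeMonomials.1 hf.1
      exact ⟨this.1, fun hV => hf.2 (mem_upperShadow.2 ⟨k, this.2, f, hV, rfl⟩)⟩
  have h2 : S ⊆ degreeMonomials n (q + 2) \
      upperShadow n (degreeMonomials n (q + 1) \ T) := by
    intro f hf
    refine Finset.mem_sdiff.2 ⟨hS hf, fun hU => ?_⟩
    obtain ⟨k, _, g, hg, rfl⟩ := mem_upperShadow.1 hU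
    exact (Finset.mem_sdiff.1 hg).2 (h g k hf)
  have h3 := Finset.card_le_card h2
  have h4 := Finset.card_sdiff_add_card_eq_card (upperShadow_subset hV)
  have h5 := Finset.card_sdiff_add_card_eq_card
    (upperShadow_subset (Finset.sdiff_subset (s := degreeMonomials n (q + 1)) (t := T)))
  have h6 := Finset.card_sdiff_add_card_eq_card hV
  have h7 := Finset.card_sdiff_add_card_eq_card hT
  rw [show (degreeMonomials n (q + 1) \ V).card = T.card by omega] at h1
  rw [show q + 1 + 1 = q + 2 from rfl] at *
  omega

/-! ### Colexicographic segments and order ideals with prescribed sizes -/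

/-- Strictness turns r < C(k, q) into r^⟨q⟩ < C(k + 1, q + 1), so a decomposition stays admissible
under `macaulayPow`. -/
theorem macaulayPow_lt_succ {q : ℕ} (hq : 1 ≤ q) (t : ℕ) :
    macaulayPow q t < macaulayPow q (t + 1) := by
  obtain ⟨q, rfl⟩ := Nat.exists_eq_add_of_le' hq
  clear hq
  induction q generalizing t with
  | zero =>
    have h (s : ℕ) : macaulayPow 1 s = (s + 1).choose 2 := by simpa using macaulayPow_choose 0 s
    rw [h, h, Nat.choose_succ_succ' (t + 1) 1, Nat.choose_one_right]
    exact Nat.lt_add_of_pos_left (by omega)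
  | succ q ih =>
    obtain ⟨k, r, rfl, hr⟩ := exists_eq_choose_add (q + 1) t
    have h4 := ih r
    rcases lt_or_ge (r + 1) (k.choose (q + 1)) with h | h
    · rw [add_assoc (k.choose _), macaulayPow_choose_add hr, macaulayPow_choose_add h]
      omega
    · have h3 := Nat.choose_succ_succ' k (q + 1)
      have e : k.choose (q + 1 + 1) + r + 1 = (k + 1).choose (q + 1 + 1) := by omega
      rw [e, macaulayPow_choose_add hr, macaulayPow_choose]
      rw [show r + 1 = k.choose (q + 1) by omega, macaulayPow_choose] at h4
      have h5 := Nat.choose_succ_succ' (k + 1) (q + 2)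
      simp only [Nat.add_assoc, Nat.reduceAdd] at *
      omega

theorem macaulayPow_strictMono {q : ℕ} (hq : 1 ≤ q) : StrictMono (macaulayPow q) :=
  strictMono_nat_of_lt_succ (macaulayPow_lt_succ hq)

theorem degreeMonomials_mono {v w : ℕ} (h : v ≤ w) (q : ℕ) :
    degreeMonomials v q ⊆ degreeMonomials w q := by
  intro f hf
  rw [mem_degreeMonomials] at hf ⊢
  exact ⟨hf.1, fun k hk => hf.2 k (h.trans hk)⟩

theorem degreeMonomials_zero_right (v : ℕ) : degreeMonomials v 0 = {0} := by
  ext f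
  rw [mem_degreeMonomials, Finset.mem_singleton, Finsupp.degree_eq_zero_iff]
  exact ⟨fun h => h.1, fun h => ⟨h, by simp [h]⟩⟩

theorem mem_degreeMonomials_of_apply_eq_zero {v q : ℕ} {f : ℕ →₀ ℕ}
    (hf : f ∈ degreeMonomials (v + 1) q) (h : f v = 0) : f ∈ degreeMonomials v q :=
  filter_subset_degreeMonomials subset_rfl (Finset.mem_filter.2 ⟨hf, h⟩)

theorem card_degreeMonomials (v q : ℕ) : (degreeMonomials (v + 1) q).card = (v + q).choose q := by
  have step : ∀ v q, (degreeMonomials (v + 1) (q + 1)).card =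
      (degreeMonomials v (q + 1)).card + (degreeMonomials (v + 1) q).card := by
    intro v q
    have e : degreeMonomials (v + 1) (q + 1) = degreeMonomials v (q + 1) ∪
        (degreeMonomials (v + 1) q).image (· + Finsupp.single v 1) := by
      ext f
      rw [Finset.mem_union, Finset.mem_image]
      constructor
      · intro hf
        by_cases h0 : f v = 0
        · exact Or.inl (mem_degreeMonomials_of_apply_eq_zero hf h0)
        · obtain ⟨g, rfl⟩ := Finsupp.exists_eq_add_single h0
          exact Or.inr ⟨g, (add_single_mem_degreeMonomials.1 hf).1, rfl⟩
      · rintro (hf | ⟨g, hg, rfl⟩)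
        · exact degreeMonomials_mono (by omega) _ hf
        · exact add_single_mem_degreeMonomials.2 ⟨hg, by omega⟩
    rw [e, Finset.card_union_of_disjoint, Finset.card_image_of_injective _ (add_left_injective _)]
    rw [Finset.disjoint_left]
    intro f hf hf'
    obtain ⟨g, hg, rfl⟩ := Finset.mem_image.1 hf'
    have := (add_single_mem_degreeMonomials.1 hf).2
    omega
  induction q generalizing v with
  | zero => simp [degreeMonomials_zero_right]
  | succ q ihq =>
    induction v with
    | zero => rw [step, ihq, degreeMonomials_zero_left]; simp
    | succ v ihv =>
      have := Nat.choose_succ_succ' (v + 1 + q) q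
      rw [step, ihv, ihq, show v + 1 + (q + 1) = v + 1 + q + 1 by omega, this,
        show v + (q + 1) = v + 1 + q by omega, add_comm]

theorem card_degreeMonomials_succ (v q : ℕ) :
    (degreeMonomials v (q + 1)).card = (v + q).choose (q + 1) := by
  rcases v with _ | v
  · rw [degreeMonomials_zero_left, Nat.choose_eq_zero_of_lt (by omega), Finset.card_empty]
  · rw [card_degreeMonomials, show v + (q + 1) = v + 1 + q by omega]

/-- The first `t` monomials of degree `q` in colexicographic order. -/
noncomputable def colexSegment : ℕ → ℕ → Finset (ℕ →₀ ℕ)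
  | 0, t => if t = 0 then ∅ else {0}
  | q + 1, t =>
    degreeMonomials (Nat.findGreatest (fun k => k.choose (q + 1) ≤ t) (t + q) - q) (q + 1) ∪
      (colexSegment q
        (t - (Nat.findGreatest (fun k => k.choose (q + 1) ≤ t) (t + q)).choose (q + 1))).image
        (· + Finsupp.single (Nat.findGreatest (fun k => k.choose (q + 1) ≤ t) (t + q) - q) 1)

theorem colexSegment_choose_add {q v r : ℕ} (hr : r < (v + q).choose q) :
    colexSegment (q + 1) ((v + q).choose (q + 1) + r) =
      degreeMonomials v (q + 1) ∪ (colexSegment q r).image (· + Finsupp.single v 1) := by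
  rw [colexSegment, findGreatest_choose_add hr, Nat.add_sub_cancel_left, Nat.add_sub_cancel]

theorem exists_eq_choose_add_choose (q t : ℕ) :
    ∃ v r : ℕ, t = (v + q).choose (q + 1) + r ∧ r < (v + q).choose q := by
  obtain ⟨k, r, h, hr⟩ := exists_eq_choose_add q t
  have : q ≤ k := by
    by_contra hlt
    rw [Nat.choose_eq_zero_of_lt (by omega)] at hr
    omega
  obtain ⟨v, rfl⟩ := Nat.exists_eq_add_of_le' this
  exact ⟨v, r, h, hr⟩

theorem colexSegment_zero_right (q : ℕ) : colexSegment q 0 = ∅ := by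
  induction q with
  | zero => simp [colexSegment]
  | succ q ih =>
    have := colexSegment_choose_add (q := q) (v := 0) (r := 0) (by simp)
    rw [zero_add, Nat.choose_eq_zero_of_lt (by omega), ih, degreeMonomials_zero_left] at this
    simpa using this

theorem colexSegment_subset_degreeMonomials {q t v : ℕ} (h : t ≤ (degreeMonomials v q).card) :
    colexSegment q t ⊆ degreeMonomials v q := by
  induction q generalizing t v with
  | zero =>
    rw [degreeMonomials_zero_right, colexSegment]
    split_ifs <;> simp
  | succ q ih =>
    rw [card_degreeMonomials_succ] at h
    obtain ⟨w, r, rfl, hr⟩ := exists_eq_choose_add_choose q t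
    have h1 := Nat.choose_succ_succ' (w + q) q
    rw [colexSegment_choose_add hr]
    have hlt : v < w → (v + q).choose (q + 1) < (w + q).choose (q + 1) := by
      intro hvw
      have h2 := Nat.choose_le_choose (q + 1) (show v + 1 + q ≤ w + q by omega)
      have h3 := Nat.choose_succ_succ' (v + q) q
      have h4 := Nat.choose_pos (show q ≤ v + q by omega)
      rw [show v + 1 + q = v + q + 1 by omega] at h2
      omega
    rcases Nat.eq_zero_or_pos r with rfl | hr0
    · rw [colexSegment_zero_right, Finset.image_empty, Finset.union_empty]
      exact degreeMonomials_mono (by by_contra; have := hlt (by omega); omega) _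
    · have hwv : w < v := by
        by_contra hcon
        rcases (not_lt.1 hcon).eq_or_lt with rfl | h'
        · omega
        · have := hlt h'
          omega
      refine Finset.union_subset (degreeMonomials_mono hwv.le _) fun f hf => ?_
      obtain ⟨g, hg, rfl⟩ := Finset.mem_image.1 hf
      have := ih (t := r) (v := w + 1) (by rw [card_degreeMonomials]; omega) hg
      exact add_single_mem_degreeMonomials.2 ⟨degreeMonomials_mono hwv _ this, hwv⟩

theorem card_colexSegment (q t : ℕ) (h : q = 0 → t ≤ 1) : (colexSegment q t).card = t := by
  induction q generalizing t with
  | zero =>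
    have := h rfl
    rw [colexSegment]
    split_ifs <;> simp <;> omega
  | succ q ih =>
    obtain ⟨v, r, rfl, hr⟩ := exists_eq_choose_add_choose q t
    rw [colexSegment_choose_add hr, Finset.card_union_of_disjoint,
      Finset.card_image_of_injective _ (add_left_injective _), card_degreeMonomials_succ, ih]
    · rintro rfl
      rw [Nat.choose_zero_right] at hr
      omega
    · rw [Finset.disjoint_left]
      intro f hf hf'
      obtain ⟨g, hg, rfl⟩ := Finset.mem_image.1 hf'
      have := (add_single_mem_degreeMonomials.1 hf).2
      omega

theorem colexSegment_mono (q : ℕ) : Monotone (colexSegment q) := by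
  induction q with
  | zero =>
    intro s t h
    rw [colexSegment, colexSegment]
    split_ifs <;> simp
    omega
  | succ q ih =>
    intro s t h
    obtain ⟨v, r, rfl, hr⟩ := exists_eq_choose_add_choose q t
    rw [colexSegment_choose_add hr]
    rcases le_or_gt s ((v + q).choose (q + 1)) with hs | hs
    · exact (colexSegment_subset_degreeMonomials (by rwa [card_degreeMonomials_succ])).trans
        Finset.subset_union_left
    · obtain ⟨r', rfl⟩ := Nat.exists_eq_add_of_le hs.le
      rw [colexSegment_choose_add (by omega)]
      exact Finset.union_subset_union_right (Finset.image_subset_image (ih (by omega)))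

/-- Passing from t to t^⟨q⟩ raises each degree by one and keeps the number v of variables at each
stage, so both segments have the same recursive shape and division by a variable respects it. -/
theorem mem_colexSegment_of_add_single_mem {q t k : ℕ} {f : ℕ →₀ ℕ} (hq : 1 ≤ q)
    (h : f + Finsupp.single k 1 ∈ colexSegment (q + 1) (macaulayPow q t)) :
    f ∈ colexSegment q t := by
  obtain ⟨q, rfl⟩ := Nat.exists_eq_add_of_le' hq
  clear hq
  induction q generalizing t k f with
  | zero =>
    obtain ⟨v, r, rfl, hr⟩ := exists_eq_choose_add_choose 0 t
    obtain rfl : r = 0 := by simpa using hr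
    rw [macaulayPow_choose_add hr, show macaulayPow 0 0 = 0 from rfl,
      show v + 0 + 1 = v + 1 from rfl, zero_add, zero_add,
      colexSegment_choose_add (by simp), colexSegment_zero_right, Finset.image_empty,
      Finset.union_empty] at h
    rw [colexSegment_choose_add hr]
    exact Finset.mem_union_left _ (add_single_mem_degreeMonomials.1 h).1
  | succ q ih =>
    obtain ⟨v, r, rfl, hr⟩ := exists_eq_choose_add_choose (q + 1) t
    have hlt := macaulayPow_strictMono (q := q + 1) (by omega) hr
    rw [macaulayPow_choose] at hlt
    rw [macaulayPow_choose_add hr, show v + (q + 1) + 1 = v + (q + 2) from rfl,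
      colexSegment_choose_add hlt, Finset.mem_union] at h
    rw [colexSegment_choose_add hr, Finset.mem_union]
    rcases h with h | h
    · exact Or.inl (add_single_mem_degreeMonomials.1 h).1
    obtain ⟨g, hg, hgf⟩ := Finset.mem_image.1 h
    by_cases hk : k = v
    · subst hk
      obtain rfl := add_right_cancel hgf
      have hg' := colexSegment_subset_degreeMonomials (v := k + 1)
        (by rw [card_degreeMonomials]; exact hlt.le) hg
      by_cases h0 : g k = 0
      · exact Or.inl (mem_degreeMonomials_of_apply_eq_zero hg' h0)
      · obtain ⟨u, rfl⟩ := Finsupp.exists_eq_add_single h0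
        exact Or.inr (Finset.mem_image.2 ⟨u, ih hg, rfl⟩)
    · have h0 : f v ≠ 0 := by
        have := DFunLike.congr_fun hgf v
        simp [Finsupp.single_eq_of_ne (Ne.symm hk)] at this
        omega
      obtain ⟨u, rfl⟩ := Finsupp.exists_eq_add_single h0
      rw [add_right_comm] at hgf
      obtain rfl := add_right_cancel hgf
      exact Or.inr (Finset.mem_image.2 ⟨u, ih hg, rfl⟩)

/-- Every numerical function with Macaulay's growth bound counts the monomials of an order
ideal of monomials. -/
theorem exists_orderIdeal_monomials {F : ℕ → ℕ} (h0 : F 0 = 1)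
    (hF : ∀ q, 1 ≤ q → F (q + 1) ≤ macaulayPow q (F q)) :
    ∃ T : ℕ → Finset (ℕ →₀ ℕ), (∀ q, (T q).card = F q) ∧
      (∀ q, T q ⊆ degreeMonomials (F 1) q) ∧
      ∀ q f k, f + Finsupp.single k 1 ∈ T (q + 1) → f ∈ T q := by
  have h1 : colexSegment 1 (F 1) ⊆ degreeMonomials (F 1) 1 :=
    colexSegment_subset_degreeMonomials (by rw [card_degreeMonomials_succ]; simp)
  have hT0 : colexSegment 0 (F 0) = {0} := by simp [h0, colexSegment]
  have hcl : ∀ q f k, f + Finsupp.single k 1 ∈ colexSegment (q + 1) (F (q + 1)) →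
      f ∈ colexSegment q (F q) := by
    intro q f k h
    rcases q with _ | q
    · rw [hT0, ← degreeMonomials_zero_right (F 1)]
      exact (add_single_mem_degreeMonomials.1 (h1 h)).1
    · exact mem_colexSegment_of_add_single_mem (by omega)
        (colexSegment_mono _ (hF (q + 1) (by omega)) h)
  refine ⟨fun q => colexSegment q (F q), fun q => card_colexSegment _ _ ?_, fun q => ?_, hcl⟩
  · rintro rfl
    exact h0.le
  rcases q with _ | q
  · dsimp only
    rw [hT0, degreeMonomials_zero_right]
  induction q with
  | zero => exact h1
  | succ q ih =>
    intro f hf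
    -- A crude number of variables, used only to find a variable dividing f.
    have hdeg : ∃ v, colexSegment (q + 2) (F (q + 2)) ⊆ degreeMonomials v (q + 2) := by
      refine ⟨F (q + 2), colexSegment_subset_degreeMonomials ?_⟩
      rw [card_degreeMonomials_succ]
      have h2 := lt_choose_add_succ (F (q + 2) - 1) (q + 1)
      rcases Nat.eq_zero_or_pos (F (q + 2)) with h3 | h3
      · omega
      · rw [show F (q + 2) - 1 + (q + 1) + 1 = F (q + 2) + (q + 1) by omega] at h2
        omega
    obtain ⟨v, hv⟩ := hdeg
    obtain ⟨k, -, hk⟩ := exists_ne_zero_of_mem_degreeMonomials (hv hf)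
    obtain ⟨g, rfl⟩ := Finsupp.exists_eq_add_single hk
    have hg := ih (hcl _ _ _ hf)
    -- The degree of f is at least 2, so a second factor x_l can be removed instead; the quotient
    -- still contains x_k, and the induction hypothesis gives k < F 1.
    obtain ⟨l, -, hl⟩ := exists_ne_zero_of_mem_degreeMonomials hg
    obtain ⟨u, rfl⟩ := Finsupp.exists_eq_add_single hl
    rw [add_right_comm u] at hf
    exact add_single_mem_degreeMonomials.2
      ⟨hg, (add_single_mem_degreeMonomials.1 (ih (hcl _ _ _ hf))).2⟩

/-! ### Standard monomials and Hilbert functions -/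

section Hilbert

attribute [local instance] MvPolynomial.gradedAlgebra

open MvPolynomial

variable {K : Type*} [Field K] {n : ℕ}

theorem MvPolynomial.isHomogeneous_ideal_iff {σ R : Type*} [CommRing R]
    {I : Ideal (MvPolynomial σ R)} : I.IsHomogeneous (homogeneousSubmodule σ R) ↔
      ∀ f ∈ I, ∀ q, homogeneousComponent q f ∈ I :=
  ⟨fun h f hf q => by simpa [← decomposition.decompose'_apply] using h q hf,
    fun h q f hf => by simpa [← decomposition.decompose'_apply] using h f hf q⟩

/-- The exponents of the lexicographically leading monomials of the members of an ideal. -/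
noncomputable def leadingExponents (I : Ideal (MvPolynomial (Fin n) K)) : Set (Fin n →₀ ℕ) :=
  {d | ∃ f ∈ I, f ≠ 0 ∧ MonomialOrder.lex.degree f = d}

theorem add_single_mem_leadingExponents {I : Ideal (MvPolynomial (Fin n) K)} {d : Fin n →₀ ℕ}
    (hd : d ∈ leadingExponents I) (i : Fin n) :
    d + Finsupp.single i 1 ∈ leadingExponents I := by
  obtain ⟨f, hf, h0, rfl⟩ := hd
  exact ⟨f * X i, I.mul_mem_right _ hf, mul_ne_zero h0 (X_ne_zero i), by
    rw [MonomialOrder.degree_mul h0 (X_ne_zero i), MonomialOrder.degree_X]⟩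

/-- The exponents of the standard monomials of degree `q` with respect to an ideal. -/
def standardExponents (I : Ideal (MvPolynomial (Fin n) K)) (q : ℕ) : Set (Fin n →₀ ℕ) :=
  {d | d.degree = q ∧ d ∉ leadingExponents I}

/-- A nontrivial relation would be a member of I whose leading exponent is standard. -/
theorem linearIndependent_standard (I : Ideal (MvPolynomial (Fin n) K)) (q : ℕ) :
    LinearIndependent K fun d : standardExponents I q =>
      (Ideal.Quotient.mkₐ K I).toLinearMap (monomial d.1 1) := by
  have h1 : LinearIndependent K fun d : standardExponents I q =>
      monomial (d : Fin n →₀ ℕ) (1 : K) := by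
    have := (basisMonomials (Fin n) K).linearIndependent.comp _
      (Subtype.val_injective (p := (· ∈ standardExponents I q)))
    simpa [Function.comp_def] using this
  refine h1.map ?_
  rw [Submodule.disjoint_def]
  intro f hf hfI
  have hr : Set.range (fun d : standardExponents I q => monomial (d : Fin n →₀ ℕ) (1 : K)) =
      (fun d => monomial d (1 : K)) '' standardExponents I q := by
    ext; simp
  rw [hr, ← restrictSupport_eq_span, mem_restrictSupport_iff] at hf
  have hfI' : f ∈ I := by
    simpa [LinearMap.mem_ker, Ideal.Quotient.eq_zero_iff_mem] using hfI
  by_contra h0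
  exact (hf (MonomialOrder.degree_mem_support (m := MonomialOrder.lex) h0)).2 ⟨f, hfI', h0, rfl⟩

theorem MvPolynomial.map_mem_of_forall_monomial {σ M : Type*} [AddCommGroup M] [Module K M]
    (φ : MvPolynomial σ K →ₗ[K] M) (N : Submodule K M) {f : MvPolynomial σ K}
    (h : ∀ d ∈ f.support, φ (monomial d 1) ∈ N) : φ f ∈ N := by
  rw [← support_sum_monomial_coeff f, map_sum]
  refine N.sum_mem fun d hd => ?_
  have := N.smul_mem (coeff d f) (h d hd)
  rwa [← map_smul, smul_monomial, smul_eq_mul, mul_one] at this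

theorem map_homogeneousSubmodule_eq_span {I : Ideal (MvPolynomial (Fin n) K)}
    (hI : I.IsHomogeneous (homogeneousSubmodule (Fin n) K)) (q : ℕ) :
    (homogeneousSubmodule (Fin n) K q).map (Ideal.Quotient.mkₐ K I).toLinearMap =
      Submodule.span K (Set.range fun d : standardExponents I q =>
        (Ideal.Quotient.mkₐ K I).toLinearMap (monomial d.1 1)) := by
  set φ := (Ideal.Quotient.mkₐ K I).toLinearMap with hφ
  have hφ0 : ∀ f, φ f = 0 ↔ f ∈ I := fun f => by
    simp [hφ, Ideal.Quotient.eq_zero_iff_mem]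
  set N := Submodule.span K (Set.range fun d : standardExponents I q => φ (monomial d.1 1))
  have key : ∀ d : Fin n →₀ ℕ, d.degree = q → φ (monomial d 1) ∈ N := by
    intro d
    induction h : MonomialOrder.lex.toSyn d using WellFoundedLT.induction generalizing d with
    | _ s ih =>
      subst h
      intro hd
      by_cases hlead : d ∈ leadingExponents I
      · obtain ⟨f, hf, h0, rfl⟩ := hlead
        set d := MonomialOrder.lex.degree f with hdf
        have hc : coeff d f ≠ 0 := MonomialOrder.coeff_degree_ne_zero_iff.2 h0
        -- The lexicographic order does not refine the degree, so f is replaced by its component of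
        -- degree q, which lies in I and keeps the leading term; all other terms are smaller and of
        -- degree q.
        set g := homogeneousComponent q f with hg
        have hgI : φ g = 0 := (hφ0 g).2 (isHomogeneous_ideal_iff.1 hI f hf q)
        have hgd : coeff d g = coeff d f := by rw [hg, coeff_homogeneousComponent, if_pos hd]
        have hrest : φ (g - monomial d (coeff d f)) ∈ N := by
          refine map_mem_of_forall_monomial φ N fun e he => ?_
          have hed : e ≠ d := by
            rintro rfl
            rw [mem_support_iff, coeff_sub, hgd, coeff_monomial, if_pos rfl, sub_self] at he
            exact he rfl
          have heg : coeff e g ≠ 0 := by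
            rwa [mem_support_iff, coeff_sub, coeff_monomial, if_neg (Ne.symm hed), sub_zero] at he
          rw [hg, coeff_homogeneousComponent] at heg
          have heq : e.degree = q := by by_contra hne; rw [if_neg hne] at heg; exact heg rfl
          rw [if_pos heq] at heg
          refine ih _ (lt_of_le_of_ne (MonomialOrder.le_degree (mem_support_iff.2 heg)) ?_) e rfl heq
          exact fun h => hed (MonomialOrder.lex.toSyn.injective h)
        rw [map_sub, hgI, zero_sub, Submodule.neg_mem_iff] at hrest
        have := N.smul_mem (coeff d f)⁻¹ hrest
        rwa [← map_smul, smul_monomial, smul_eq_mul, inv_mul_cancel₀ hc] at this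
      · exact Submodule.subset_span ⟨⟨d, hd, hlead⟩, rfl⟩
  apply le_antisymm
  · rintro _ ⟨f, hf, rfl⟩
    refine map_mem_of_forall_monomial φ N fun d hd => key d ?_
    by_contra hne
    exact mem_support_iff.1 hd (IsHomogeneous.coeff_eq_zero hf hne)
  · rw [Submodule.span_le]
    rintro _ ⟨d, rfl⟩
    exact Submodule.mem_map_of_mem (isHomogeneous_monomial _ d.2.1)

theorem quotHilbert_eq_card {I : Ideal (MvPolynomial (Fin n) K)}
    (hI : I.IsHomogeneous (homogeneousSubmodule (Fin n) K)) (q : ℕ) :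
    quotHilbert K n I q = Nat.card (standardExponents I q) := by
  rw [quotHilbert, map_homogeneousSubmodule_eq_span hI,
    Module.finrank_eq_nat_card_basis (Module.Basis.span (linearIndependent_standard I q))]

/-- View exponents in `n` variables as exponents in the variables indexed by `ℕ`. -/
noncomputable def extendExponent (d : Fin n →₀ ℕ) : ℕ →₀ ℕ := d.mapDomain Fin.val

theorem extendExponent_injective : Function.Injective (extendExponent (n := n)) :=
  Finsupp.mapDomain_injective Fin.val_injective

theorem extendExponent_add_single (d : Fin n →₀ ℕ) (i : Fin n) :
    extendExponent (d + Finsupp.single i 1) = extendExponent d + Finsupp.single (i : ℕ) 1 := by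
  rw [extendExponent, Finsupp.mapDomain_add, Finsupp.mapDomain_single, extendExponent]

theorem extendExponent_apply (d : Fin n →₀ ℕ) (i : Fin n) : extendExponent d i = d i :=
  Finsupp.mapDomain_apply Fin.val_injective _ _

theorem extendExponent_mem (d : Fin n →₀ ℕ) :
    extendExponent d ∈ degreeMonomials n d.degree := by
  rw [mem_degreeMonomials, extendExponent, Finsupp.degree_mapDomain]
  refine ⟨rfl, fun k hk => Finsupp.mapDomain_of_notMem_range _ _ ?_⟩
  rintro ⟨i, rfl⟩
  omega

theorem finite_standardExponents (I : Ideal (MvPolynomial (Fin n) K)) (q : ℕ) :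
    (standardExponents I q).Finite :=
  (Finsupp.finite_of_degree_eq q).subset fun _ h => h.1

/-- **Macaulay's theorem**: the growth bound for Hilbert functions. -/
theorem quotHilbert_succ_le {I : Ideal (MvPolynomial (Fin n) K)}
    (hI : I.IsHomogeneous (homogeneousSubmodule (Fin n) K)) {q : ℕ} (hq : 1 ≤ q) :
    quotHilbert K n I (q + 1) ≤ macaulayPow q (quotHilbert K n I q) := by
  set T : ℕ → Finset (ℕ →₀ ℕ) := fun q =>
    (finite_standardExponents I q).toFinset.image extendExponent with hT
  have hcard : ∀ q, quotHilbert K n I q = (T q).card := by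
    intro q
    rw [quotHilbert_eq_card hI, hT, Finset.card_image_of_injective _ extendExponent_injective,
      Nat.card_coe_set_eq, Set.ncard_eq_toFinset_card _ (finite_standardExponents I q)]
  have hsub : ∀ q, T q ⊆ degreeMonomials n q := by
    intro q f hf
    obtain ⟨d, hd, rfl⟩ := Finset.mem_image.1 hf
    rw [Set.Finite.mem_toFinset] at hd
    exact hd.1 ▸ extendExponent_mem d
  rw [hcard, hcard]
  refine card_le_macaulayPow hq (hsub q) (hsub _) fun f k hf => ?_
  have hk := (add_single_mem_degreeMonomials.1 (hsub _ hf)).2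
  obtain ⟨d, hd, hdf⟩ := Finset.mem_image.1 hf
  lift k to Fin n using hk
  have hdk : d k ≠ 0 := by
    rw [← extendExponent_apply, hdf]
    simp
  obtain ⟨e, rfl⟩ := Finsupp.exists_eq_add_single hdk
  rw [extendExponent_add_single] at hdf
  obtain rfl := add_right_cancel hdf
  rw [Set.Finite.mem_toFinset] at hd
  refine Finset.mem_image_of_mem _ ((Set.Finite.mem_toFinset _).2 ⟨?_, fun h =>
    hd.2 (add_single_mem_leadingExponents h k)⟩)
  have := hd.1
  rw [map_add, Finsupp.degree_single] at this
  omega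

end Hilbert

/-! ### Regular sequences in terms of ideals -/

section RegularSequences

variable {R : Type*} [CommRing R]

/-- `f` is a non-zero-divisor on `R ⧸ I`. -/
def RegularModulo (I : Ideal R) (f : R) : Prop := ∀ a, f * a ∈ I → a ∈ I

/-- The ideals `I, I + (f₁), I + (f₁, f₂), …` modulo which the members of the list `f₁, f₂, …`
have to be non-zero-divisors for the list to be a weakly regular sequence on `R ⧸ I`. -/
def partialIdeals (I : Ideal R) : List R → List (Ideal R)
  | [] => []
  | f :: fs => I :: partialIdeals (I ⊔ Ideal.span {f}) fs

/-- `f₁, f₂, …` is a weakly regular sequence on `R ⧸ I`. -/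
def RegularSequenceModulo (I : Ideal R) : List R → Prop
  | [] => True
  | f :: fs => RegularModulo I f ∧ RegularSequenceModulo (I ⊔ Ideal.span {f}) fs

theorem regularModulo_iff {I : Ideal R} {f : R} :
    RegularModulo I f ↔ IsSMulRegular (R ⧸ I) f :=
  (isSMulRegular_quotient_iff_mem_of_smul_mem I f).symm

theorem mk_mem_smul_top_iff (I J : Ideal R) (a : R) :
    Ideal.Quotient.mk I a ∈ (J • ⊤ : Submodule R (R ⧸ I)) ↔ a ∈ I ⊔ J := by
  have h : (J • ⊤ : Submodule R (R ⧸ I)) = Submodule.map (Submodule.mkQ I) J := by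
    have := Submodule.map_smul'' J (⊤ : Submodule R R) (Submodule.mkQ I)
    rw [Submodule.map_top, Submodule.range_mkQ] at this
    rw [← this, smul_eq_mul, Ideal.mul_top]
  rw [h, ← Submodule.comap_map_mkQ]
  rfl

theorem isSMulRegular_quotient_smul_top_iff (I J : Ideal R) (f : R) :
    IsSMulRegular ((R ⧸ I) ⧸ (J • ⊤ : Submodule R (R ⧸ I))) f ↔ RegularModulo (I ⊔ J) f := by
  rw [isSMulRegular_quotient_iff_mem_of_smul_mem]
  constructor
  · intro h a ha
    rw [← mk_mem_smul_top_iff] at ha ⊢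
    refine h _ ?_
    rwa [Algebra.smul_def, Ideal.Quotient.algebraMap_eq, ← map_mul]
  · intro h x hx
    obtain ⟨a, rfl⟩ := Ideal.Quotient.mk_surjective x
    rw [Algebra.smul_def, Ideal.Quotient.algebraMap_eq, ← map_mul, mk_mem_smul_top_iff] at hx
    exact (mk_mem_smul_top_iff _ _ _).2 (h a hx)

theorem regularSequenceModulo_iff_forall {I : Ideal R} {rs : List R} :
    RegularSequenceModulo I rs ↔
      ∀ (i : ℕ) (h : i < rs.length), RegularModulo (I ⊔ Ideal.ofList (rs.take i)) rs[i] := by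
  induction rs generalizing I with
  | nil => simp [RegularSequenceModulo]
  | cons f fs ih =>
    rw [RegularSequenceModulo, ih]
    constructor
    · rintro ⟨h0, h⟩ i hi
      rcases i with _ | i
      · simpa using h0
      · have := h i (by simpa using hi)
        rwa [sup_assoc, ← Ideal.ofList_cons] at this
    · intro h
      have h0 := h 0 (by simp)
      rw [List.take_zero, Ideal.ofList_nil, sup_bot_eq] at h0
      refine ⟨h0, fun i hi => ?_⟩
      have := h (i + 1) (by simpa using hi)
      rwa [sup_assoc, ← Ideal.ofList_cons]

theorem isWeaklyRegular_iff_regularSequenceModulo {I : Ideal R} {rs : List R} :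
    RingTheory.Sequence.IsWeaklyRegular (R ⧸ I) rs ↔ RegularSequenceModulo I rs := by
  rw [regularSequenceModulo_iff_forall]
  constructor
  · intro h i hi
    exact (isSMulRegular_quotient_smul_top_iff _ _ _).1 (h.regular_mod_prev i hi)
  · intro h
    exact ⟨fun i hi => (isSMulRegular_quotient_smul_top_iff _ _ _).2 (h i hi)⟩

theorem isRegular_of_regularSequenceModulo {I : Ideal R} {rs : List R}
    (h : RegularSequenceModulo I rs) (h1 : I ⊔ Ideal.ofList rs ≠ ⊤) :
    RingTheory.Sequence.IsRegular (R ⧸ I) rs := by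
  refine ⟨isWeaklyRegular_iff_regularSequenceModulo.2 h, fun htop => h1 ?_⟩
  rw [Ideal.eq_top_iff_one, ← mk_mem_smul_top_iff, ← htop]
  trivial

theorem RegularSequenceModulo.exists_regularModulo {I : Ideal R} {rs : List R}
    (h : RegularSequenceModulo I rs) : ∀ J ∈ partialIdeals I rs, ∃ f ∈ rs, RegularModulo J f := by
  induction rs generalizing I with
  | nil => simp [partialIdeals]
  | cons f fs ih =>
    intro J hJ
    rw [partialIdeals, List.mem_cons] at hJ
    rcases hJ with rfl | hJ
    · exact ⟨f, by simp, h.1⟩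
    · obtain ⟨g, hg, hg'⟩ := ih h.2 J hJ
      exact ⟨g, by simp [hg], hg'⟩

/-- A weakly regular sequence stays weakly regular, except for its last member, modulo an element
that is regular modulo all of its partial ideals. -/
theorem RegularSequenceModulo.dropLast {I : Ideal R} {rs : List R} {z : R}
    (h : RegularSequenceModulo I rs) (hz : ∀ J ∈ partialIdeals I rs, RegularModulo J z) :
    RegularSequenceModulo (I ⊔ Ideal.span {z}) rs.dropLast := by
  induction rs generalizing I with
  | nil => trivial
  | cons f fs ih =>
    rcases fs with _ | ⟨g, fs⟩
    · trivial
    rw [List.dropLast_cons_cons]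
    rw [partialIdeals, List.forall_mem_cons] at hz
    refine ⟨fun a ha => ?_, ?_⟩
    -- From f a = i + b z follows z b ∈ I + (f), hence b = i' + c f; then f (a - z c) ∈ I, and
    -- regularity of f gives a ∈ I + (z).
    · obtain ⟨i, hi, y, hy, hiy⟩ := Submodule.mem_sup.1 ha
      obtain ⟨b, rfl⟩ := Ideal.mem_span_singleton'.1 hy
      have hzb : z * b ∈ I ⊔ Ideal.span {f} := by
        have : z * b = f * a - i := by rw [← hiy]; ring
        rw [this]
        exact Ideal.sub_mem _ (Ideal.mul_mem_right _ _
          (Ideal.mem_sup_right (Ideal.mem_span_singleton_self f))) (Ideal.mem_sup_left hi)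
      have hb := hz.2 _ (by simp [partialIdeals]) b hzb
      obtain ⟨i', hi', y', hy', hb'⟩ := Submodule.mem_sup.1 hb
      obtain ⟨c, rfl⟩ := Ideal.mem_span_singleton'.1 hy'
      have hac : a - z * c ∈ I := by
        refine h.1 _ ?_
        have : f * (a - z * c) = i + z * i' := by
          have e : i' = b - c * f := by rw [← hb']; ring
          rw [mul_sub, ← hiy, e]; ring
        rw [this]
        exact I.add_mem hi (I.mul_mem_left _ hi')
      have : a = (a - z * c) + c * z := by ring
      rw [this]
      exact Ideal.add_mem _ (Ideal.mem_sup_left hac)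
        (Ideal.mul_mem_left _ _ (Ideal.mem_sup_right (Ideal.mem_span_singleton_self z)))
    · rw [sup_right_comm]
      exact ih h.2 hz.2

end RegularSequences

/-! ### Generic linear forms and hyperplane sections -/

section HyperplaneSection

attribute [local instance] MvPolynomial.gradedAlgebra

open MvPolynomial

variable {K : Type*} [Field K] {n : ℕ}

/-- Over an infinite field there is a linear form that is regular modulo each of finitely many
ideals, provided that for each of them the irrelevant ideal contains a regular element. -/
theorem exists_linear_regularModulo [Infinite K] (S : List (Ideal (MvPolynomial (Fin n) K)))
    (hS : ∀ J ∈ S, ∃ f ∈ idealOfVars (Fin n) K, RegularModulo J f) :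
    ∃ z ∈ homogeneousSubmodule (Fin n) K 1, ∀ J ∈ S, RegularModulo J z := by
  classical
  have hfin : ({P | ∃ J ∈ S, P ∈ associatedPrimes (MvPolynomial (Fin n) K)
      (MvPolynomial (Fin n) K ⧸ J)} : Set (Ideal (MvPolynomial (Fin n) K))).Finite := by
    have : {P | ∃ J ∈ S, P ∈ associatedPrimes (MvPolynomial (Fin n) K)
        (MvPolynomial (Fin n) K ⧸ J)} = ⋃ J ∈ S.toFinset, associatedPrimes
          (MvPolynomial (Fin n) K) (MvPolynomial (Fin n) K ⧸ J) := by
      ext; simp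
    rw [this]
    exact Set.Finite.biUnion S.toFinset.finite_toSet fun J _ => associatedPrimes.finite _ _
  set V := homogeneousSubmodule (Fin n) K 1
  let φ : Ideal (MvPolynomial (Fin n) K) → Submodule K V :=
    fun P => (P.restrictScalars K).comap V.subtype
  -- An associated prime containing all linear forms would contain the irrelevant ideal and with it
  -- a regular element.
  have htop : ⊤ ∉ hfin.toFinset.image φ := by
    intro h
    obtain ⟨P, hP, hPtop⟩ := Finset.mem_image.1 h
    obtain ⟨J, hJ, hPJ⟩ := (Set.Finite.mem_toFinset _).1 hP
    obtain ⟨f, hf, hfJ⟩ := hS J hJ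
    have hle : idealOfVars (Fin n) K ≤ P := by
      rw [Ideal.span_le]
      rintro _ ⟨i, rfl⟩
      have : (⟨X i, isHomogeneous_X K i⟩ : V) ∈ φ P := by rw [hPtop]; trivial
      exact this
    have hmem : f ∈ ⋃ p ∈ associatedPrimes (MvPolynomial (Fin n) K)
        (MvPolynomial (Fin n) K ⧸ J), (p : Set (MvPolynomial (Fin n) K)) :=
      Set.mem_biUnion hPJ (hle hf)
    rw [biUnion_associatedPrimes_eq_compl_regular] at hmem
    exact hmem (regularModulo_iff.1 hfJ)
  -- Over an infinite field, a vector space is not a finite union of proper subspaces.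
  obtain ⟨z, hz⟩ := (Set.ne_univ_iff_exists_notMem _).1
    (Subspace.biUnion_ne_univ_of_top_notMem htop)
  refine ⟨z, z.2, fun J hJ => regularModulo_iff.2 ?_⟩
  by_contra hreg
  have : (z : MvPolynomial (Fin n) K) ∈ {r | IsSMulRegular (MvPolynomial (Fin n) K ⧸ J) r}ᶜ := hreg
  rw [← biUnion_associatedPrimes_eq_compl_regular] at this
  obtain ⟨P, hP, hzP⟩ := Set.mem_iUnion₂.1 this
  exact hz (Set.mem_biUnion (Finset.mem_coe.2 (Finset.mem_image_of_mem _
    ((Set.Finite.mem_toFinset _).2 ⟨J, hJ, hP⟩))) hzP)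

theorem MvPolynomial.homogeneousComponent_linear_mul {z : MvPolynomial (Fin n) K}
    (hz : z ∈ homogeneousSubmodule (Fin n) K 1) (g : MvPolynomial (Fin n) K) (q : ℕ) :
    homogeneousComponent (q + 1) (z * g) = z * homogeneousComponent q g := by
  have := DirectSum.coe_decompose_mul_add_of_left_mem (homogeneousSubmodule (Fin n) K)
    (j := q) (b := g) hz
  rw [add_comm 1 q] at this
  simpa [← decomposition.decompose'_apply] using this

theorem isHomogeneous_sup_span_linear {I : Ideal (MvPolynomial (Fin n) K)}
    (hI : I.IsHomogeneous (homogeneousSubmodule (Fin n) K)) {z : MvPolynomial (Fin n) K}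
    (hz : z ∈ homogeneousSubmodule (Fin n) K 1) :
    (I ⊔ Ideal.span {z}).IsHomogeneous (homogeneousSubmodule (Fin n) K) := by
  refine hI.sup (Ideal.homogeneous_span _ _ ?_)
  rintro _ rfl
  exact ⟨1, hz⟩

theorem sup_span_linear_ne_top {I : Ideal (MvPolynomial (Fin n) K)}
    (hI : I.IsHomogeneous (homogeneousSubmodule (Fin n) K)) (h1 : I ≠ ⊤)
    {z : MvPolynomial (Fin n) K} (hz : z ∈ homogeneousSubmodule (Fin n) K 1) :
    I ⊔ Ideal.span {z} ≠ ⊤ := by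
  intro h
  rw [Ideal.eq_top_iff_one] at h
  obtain ⟨i, hi, y, hy, hiy⟩ := Submodule.mem_sup.1 h
  obtain ⟨b, rfl⟩ := Ideal.mem_span_singleton'.1 hy
  apply h1
  rw [Ideal.eq_top_iff_one]
  have hz0 : coeff 0 z = 0 := IsHomogeneous.coeff_eq_zero hz (by simp)
  have hi0 : coeff 0 i = 1 := by
    have := congrArg constantCoeff hiy
    rw [map_add, map_mul, constantCoeff_eq, hz0] at this
    simpa [constantCoeff_eq] using this
  have := isHomogeneous_ideal_iff.1 hI i hi 0
  rwa [homogeneousComponent_zero, hi0, map_one] at this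

theorem quotHilbert_zero {I : Ideal (MvPolynomial (Fin n) K)} (h1 : I ≠ ⊤) :
    quotHilbert K n I 0 = 1 := by
  rw [quotHilbert, homogeneousSubmodule_zero, Submodule.one_eq_span, Submodule.map_span,
    Set.image_singleton]
  refine finrank_span_singleton ?_
  rw [Ne, AlgHom.toLinearMap_apply, Ideal.Quotient.mkₐ_eq_mk, Ideal.Quotient.eq_zero_iff_mem,
    ← Ideal.eq_top_iff_one]
  exact h1

/-- Rank-nullity for 0 → (A/I)_q → (A/I)_{q+1} → (A/(I + (z)))_{q+1} → 0, whose first map is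
multiplication by z. -/
theorem quotHilbert_sup_span_linear {I : Ideal (MvPolynomial (Fin n) K)}
    (hI : I.IsHomogeneous (homogeneousSubmodule (Fin n) K)) {z : MvPolynomial (Fin n) K}
    (hz : z ∈ homogeneousSubmodule (Fin n) K 1) (hreg : RegularModulo I z) (q : ℕ) :
    quotHilbert K n (I ⊔ Ideal.span {z}) (q + 1) + quotHilbert K n I q =
      quotHilbert K n I (q + 1) := by
  set J := I ⊔ Ideal.span {z} with hJ
  set U := (homogeneousSubmodule (Fin n) K (q + 1)).map (Ideal.Quotient.mkₐ K I).toLinearMap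
    with hU
  set W := (homogeneousSubmodule (Fin n) K q).map (Ideal.Quotient.mkₐ K I).toLinearMap with hW
  let π : (MvPolynomial (Fin n) K ⧸ I) →ₗ[K] (MvPolynomial (Fin n) K ⧸ J) :=
    (Ideal.Quotient.factorₐ K (le_sup_left : I ≤ J)).toLinearMap
  have hπ : ∀ f, π (Ideal.Quotient.mk I f) = Ideal.Quotient.mk J f := fun f => rfl
  let μ : (MvPolynomial (Fin n) K ⧸ I) →ₗ[K] (MvPolynomial (Fin n) K ⧸ I) :=
    LinearMap.mulLeft K (Ideal.Quotient.mk I z)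
  have hμ : ∀ f, μ (Ideal.Quotient.mk I f) = Ideal.Quotient.mk I (z * f) := fun f => by
    simp [μ]
  have hμinj : Function.Injective μ := by
    rw [injective_iff_map_eq_zero]
    intro x hx
    obtain ⟨f, rfl⟩ := Ideal.Quotient.mk_surjective x
    rw [hμ, Ideal.Quotient.eq_zero_iff_mem] at hx
    exact Ideal.Quotient.eq_zero_iff_mem.2 (hreg f hx)
  have hrange : (π.domRestrict U).range =
      (homogeneousSubmodule (Fin n) K (q + 1)).map (Ideal.Quotient.mkₐ K J).toLinearMap := by
    rw [LinearMap.range_domRestrict, hU, ← Submodule.map_comp]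
    rfl
  have hker : (π.domRestrict U).ker.map U.subtype = W.map μ := by
    ext x
    constructor
    · rintro ⟨⟨_, f, hf, rfl⟩, hx, rfl⟩
      have hfJ : f ∈ J := Ideal.Quotient.eq_zero_iff_mem.1 hx
      obtain ⟨i, hi, y, hy, hiy⟩ := Submodule.mem_sup.1 hfJ
      obtain ⟨b, rfl⟩ := Ideal.mem_span_singleton'.1 hy
      -- As f - z b ∈ I and I is homogeneous, b may be replaced by its component of degree q.
      refine ⟨Ideal.Quotient.mk I (homogeneousComponent q b),
        ⟨_, homogeneousComponent_mem q b, rfl⟩, ?_⟩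
      rw [hμ]
      change _ = Ideal.Quotient.mk I f
      rw [eq_comm, Ideal.Quotient.eq, ← homogeneousComponent_linear_mul hz]
      have h2 : homogeneousComponent (q + 1) f = f := by
        rw [homogeneousComponent_of_mem hf, if_pos rfl]
      nth_rw 1 [← h2]
      rw [← map_sub]
      refine isHomogeneous_ideal_iff.1 hI _ ?_ _
      have : f - z * b = i := by rw [← hiy]; ring
      rwa [this]
    · rintro ⟨_, ⟨f, hf, rfl⟩, rfl⟩
      have hzf : z * f ∈ homogeneousSubmodule (Fin n) K (q + 1) := by
        rw [add_comm q 1]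
        exact IsHomogeneous.mul hz hf
      refine ⟨⟨Ideal.Quotient.mk I (z * f), ⟨_, hzf, rfl⟩⟩, ?_, (hμ f).symm⟩
      change Ideal.Quotient.mk J (z * f) = 0
      exact Ideal.Quotient.eq_zero_iff_mem.2 (Ideal.mul_mem_right _ _
        (Ideal.mem_sup_right (Ideal.mem_span_singleton_self z)))
  have hfinU : FiniteDimensional K U := by
    rw [hU, map_homogeneousSubmodule_eq_span hI]
    have := (finite_standardExponents I (q + 1)).to_subtype
    exact FiniteDimensional.span_of_finite K (Set.finite_range _)
  have h1 := LinearMap.finrank_range_add_finrank_ker (π.domRestrict U)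
  rw [hrange, ← Submodule.finrank_map_subtype_eq U, hker,
    ← (Submodule.equivMapOfInjective μ hμinj W).finrank_eq] at h1
  exact h1

theorem quotHilbert_sup_span_linear_eq_differential {I : Ideal (MvPolynomial (Fin n) K)}
    (hI : I.IsHomogeneous (homogeneousSubmodule (Fin n) K)) (h1 : I ≠ ⊤)
    {z : MvPolynomial (Fin n) K}
    (hz : z ∈ homogeneousSubmodule (Fin n) K 1) (hreg : RegularModulo I z) :
    (fun q => (quotHilbert K n (I ⊔ Ideal.span {z}) q : ℤ)) =
      differential fun q => (quotHilbert K n I q : ℤ) := by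
  funext q
  rcases q with _ | q
  · rw [quotHilbert_zero (sup_span_linear_ne_top hI h1 hz)]
    rfl
  · rw [differential, ← quotHilbert_sup_span_linear hI hz hreg q]
    push_cast
    ring

theorem iterDifferential_succ (p : ℕ) (H : ℕ → ℕ) {G : ℕ → ℕ}
    (hG : (fun q => (G q : ℤ)) = differential fun q => (H q : ℤ)) :
    iterDifferential (p + 1) H = iterDifferential p G := by
  rw [iterDifferential, iterDifferential, Function.iterate_succ_apply, hG]

/-- If `A ⧸ I` has a regular sequence of length `r` in the irrelevant ideal, then the `r`-th
differential of its Hilbert function is again a Hilbert function. -/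
theorem exists_quotHilbert_eq_iterDifferential [Infinite K]
    {I : Ideal (MvPolynomial (Fin n) K)}
    (hI : I.IsHomogeneous (homogeneousSubmodule (Fin n) K)) (h1 : I ≠ ⊤)
    {rs : List (MvPolynomial (Fin n) K)} (hrs : ∀ f ∈ rs, f ∈ idealOfVars (Fin n) K)
    (hreg : RegularSequenceModulo I rs) :
    ∃ J : Ideal (MvPolynomial (Fin n) K), J.IsHomogeneous (homogeneousSubmodule (Fin n) K) ∧
      (fun q => (quotHilbert K n J q : ℤ)) = iterDifferential rs.length (quotHilbert K n I) := by
  induction hr : rs.length generalizing I rs with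
  | zero => exact ⟨I, hI, rfl⟩
  | succ r ih =>
    -- One z serves all partial ideals at once, so modulo z the sequence stays regular after giving
    -- up only its last member.
    obtain ⟨z, hz, hzreg⟩ := exists_linear_regularModulo (partialIdeals I rs) fun J hJ => by
      obtain ⟨f, hf, hfJ⟩ := hreg.exists_regularModulo J hJ
      exact ⟨f, hrs f hf, hfJ⟩
    have hzI : RegularModulo I z := by
      rcases rs with _ | ⟨f, fs⟩
      · simp at hr
      · exact hzreg I (by simp [partialIdeals])
    obtain ⟨J, hJ, hJH⟩ := ih (isHomogeneous_sup_span_linear hI hz)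
      (sup_span_linear_ne_top hI h1 hz)
      (fun f hf => hrs f (List.mem_of_mem_dropLast hf)) (hreg.dropLast hzreg)
      (by rw [List.length_dropLast, hr, Nat.add_sub_cancel])
    exact ⟨J, hJ, hJH.trans (iterDifferential_succ _ _
      (quotHilbert_sup_span_linear_eq_differential hI h1 hz hzI)).symm⟩

theorem hasMacaulayGrowth_quotHilbert {I : Ideal (MvPolynomial (Fin n) K)}
    (hI : I.IsHomogeneous (homogeneousSubmodule (Fin n) K)) :
    HasMacaulayGrowth fun q => (quotHilbert K n I q : ℤ) :=
  ⟨fun _ => Int.natCast_nonneg _, fun q hq => by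
    rw [Int.toNat_natCast]
    exact Int.ofNat_le.2 (quotHilbert_succ_le hI hq)⟩

end HyperplaneSection

/-! ### Extension of the base field -/

section FieldExtension

attribute [local instance] MvPolynomial.gradedAlgebra

open MvPolynomial

variable {σ K L : Type*} [Field K] [Field L] [Algebra K L] {n : ℕ}

/-- Apply a linear functional to the coefficients of a polynomial. -/
noncomputable def applyCoeff (φ : L →ₗ[K] K) (p : MvPolynomial σ L) : MvPolynomial σ K :=
  ∑ d ∈ p.support, monomial d (φ (coeff d p))

theorem coeff_applyCoeff (φ : L →ₗ[K] K) (p : MvPolynomial σ L) (d : σ →₀ ℕ) :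
    coeff d (applyCoeff φ p) = φ (coeff d p) := by
  classical
  rw [applyCoeff, coeff_sum]
  simp_rw [coeff_monomial]
  rw [Finset.sum_ite_eq' p.support d]
  split_ifs with h
  · rfl
  · rw [notMem_support_iff.1 h, map_zero]

theorem applyCoeff_zero (φ : L →ₗ[K] K) : applyCoeff φ (0 : MvPolynomial σ L) = 0 := by
  ext d; simp [coeff_applyCoeff]

theorem applyCoeff_add (φ : L →ₗ[K] K) (p q : MvPolynomial σ L) :
    applyCoeff φ (p + q) = applyCoeff φ p + applyCoeff φ q := by
  ext d; simp [coeff_applyCoeff]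

theorem applyCoeff_map_mul (φ : L →ₗ[K] K) (g : MvPolynomial σ K) (p : MvPolynomial σ L) :
    applyCoeff φ (map (algebraMap K L) g * p) = g * applyCoeff φ p := by
  classical
  ext d
  rw [coeff_applyCoeff, coeff_mul, coeff_mul, map_sum]
  refine Finset.sum_congr rfl fun x _ => ?_
  rw [coeff_map, ← Algebra.smul_def, map_smul, smul_eq_mul, coeff_applyCoeff]

theorem homogeneousComponent_applyCoeff (φ : L →ₗ[K] K) (p : MvPolynomial σ L) (q : ℕ) :
    homogeneousComponent q (applyCoeff φ p) = applyCoeff φ (homogeneousComponent q p) := by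
  ext d
  rw [coeff_homogeneousComponent, coeff_applyCoeff, coeff_applyCoeff, coeff_homogeneousComponent]
  split_ifs <;> simp

theorem support_applyCoeff_subset (φ : L →ₗ[K] K) (p : MvPolynomial σ L) :
    (applyCoeff φ p).support ⊆ p.support := by
  intro d hd
  rw [mem_support_iff, coeff_applyCoeff] at hd
  rw [mem_support_iff]
  intro h
  rw [h, map_zero] at hd
  exact hd rfl

/-- `applyCoeff φ` is linear over K[x], so it maps the extended ideal into I. Conversely, expanding
the coefficients of p in a K-basis of L writes p as a combination of its coordinate polynomials.
This takes the place of flatness of L[x] over K[x]. -/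
theorem mem_map_iff_forall_applyCoeff {I : Ideal (MvPolynomial σ K)} {p : MvPolynomial σ L} :
    p ∈ I.map (map (algebraMap K L)) ↔ ∀ φ : L →ₗ[K] K, applyCoeff φ p ∈ I := by
  classical
  constructor
  · intro hp φ
    induction hp using Submodule.closure_induction with
    | zero => rw [applyCoeff_zero]; exact I.zero_mem
    | add x y _ _ hx hy => rw [applyCoeff_add]; exact I.add_mem hx hy
    | smul_mem r x hx =>
      obtain ⟨g, hg, rfl⟩ := hx
      rw [smul_eq_mul, mul_comm, applyCoeff_map_mul]
      exact I.mul_mem_right _ hg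
  · intro h
    let b := Module.Basis.ofVectorSpace K L
    set F := p.support.biUnion fun d => (b.repr (coeff d p)).support with hF
    have hp : p = ∑ j ∈ F, C (b j) * map (algebraMap K L) (applyCoeff (b.coord j) p) := by
      ext d
      rw [coeff_sum]
      simp_rw [coeff_C_mul, coeff_map, coeff_applyCoeff, Module.Basis.coord_apply]
      by_cases hd : coeff d p = 0
      · simp [hd]
      · conv_lhs => rw [← b.linearCombination_repr (coeff d p)]
        rw [Finsupp.linearCombination_apply, Finsupp.sum]
        rw [Finset.sum_subset (Finset.subset_biUnion_of_mem
          (fun d => (b.repr (coeff d p)).support) (mem_support_iff.2 hd))]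
        · refine Finset.sum_congr rfl fun j _ => ?_
          rw [Algebra.smul_def, mul_comm]
        · intro j _ hj
          rw [Finsupp.notMem_support_iff.1 hj, zero_smul]
    rw [hp]
    exact Ideal.sum_mem _ fun j _ => Ideal.mul_mem_left _ _ (Ideal.mem_map_of_mem _ (h _))

theorem RegularModulo.map_algebraMap {I : Ideal (MvPolynomial σ K)} {f : MvPolynomial σ K}
    (h : RegularModulo I f) :
    RegularModulo (I.map (map (algebraMap K L))) (map (algebraMap K L) f) := by
  intro a ha
  rw [mem_map_iff_forall_applyCoeff] at ha ⊢
  intro φ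
  have := ha φ
  rw [applyCoeff_map_mul] at this
  exact h _ this

theorem RegularSequenceModulo.map_algebraMap {I : Ideal (MvPolynomial σ K)}
    {rs : List (MvPolynomial σ K)} (h : RegularSequenceModulo I rs) :
    RegularSequenceModulo (I.map (map (algebraMap K L))) (rs.map (map (algebraMap K L))) := by
  induction rs generalizing I with
  | nil => trivial
  | cons f fs ih =>
    refine ⟨h.1.map_algebraMap, ?_⟩
    have := ih h.2
    rwa [Ideal.map_sup, Ideal.map_span, Set.image_singleton] at this

theorem isHomogeneous_map_algebraMap {I : Ideal (MvPolynomial σ K)}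
    (hI : I.IsHomogeneous (homogeneousSubmodule σ K)) :
    (I.map (map (algebraMap K L))).IsHomogeneous (homogeneousSubmodule σ L) := by
  rw [isHomogeneous_ideal_iff] at hI ⊢
  intro f hf q
  rw [mem_map_iff_forall_applyCoeff] at hf ⊢
  intro φ
  rw [← homogeneousComponent_applyCoeff]
  exact hI _ (hf φ) q

/-- A functional that does not kill the leading coefficient keeps the leading exponent. -/
theorem leadingExponents_map_algebraMap (I : Ideal (MvPolynomial (Fin n) K)) :
    leadingExponents (I.map (map (algebraMap K L))) = leadingExponents I := by
  ext d
  constructor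
  · rintro ⟨p, hp, h0, rfl⟩
    set d := MonomialOrder.lex.degree p with hd
    have hc : coeff d p ≠ 0 := MonomialOrder.coeff_degree_ne_zero_iff.2 h0
    obtain ⟨φ, hφ⟩ : ∃ φ : Module.Dual K L, φ (coeff d p) ≠ 0 := by
      by_contra! h
      exact hc ((Module.forall_dual_apply_eq_zero_iff K _).1 h)
    have hds : d ∈ (applyCoeff φ p).support := by rwa [mem_support_iff, coeff_applyCoeff]
    have hne : applyCoeff φ p ≠ 0 := by
      rintro h
      simp [h] at hds
    refine ⟨applyCoeff φ p, mem_map_iff_forall_applyCoeff.1 hp φ, hne, ?_⟩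
    exact MonomialOrder.lex.toSyn.injective (le_antisymm
      (MonomialOrder.le_degree (support_applyCoeff_subset φ p
        (MonomialOrder.degree_mem_support hne))) (MonomialOrder.le_degree hds))
  · rintro ⟨f, hf, h0, rfl⟩
    have hinj := (algebraMap K L).injective
    have hs := support_map_of_injective f hinj
    have hne : map (algebraMap K L) f ≠ 0 := fun h =>
      h0 (map_injective _ hinj (by rw [h, map_zero]))
    refine ⟨map (algebraMap K L) f, Ideal.mem_map_of_mem _ hf, hne, ?_⟩
    refine MonomialOrder.lex.toSyn.injective (le_antisymm
      (MonomialOrder.le_degree ?_) (MonomialOrder.le_degree ?_))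
    · rw [← hs]
      exact MonomialOrder.degree_mem_support hne
    · rw [hs]
      exact MonomialOrder.degree_mem_support h0

theorem quotHilbert_map_algebraMap {I : Ideal (MvPolynomial (Fin n) K)}
    (hI : I.IsHomogeneous (homogeneousSubmodule (Fin n) K)) :
    quotHilbert L n (I.map (map (algebraMap K L))) = quotHilbert K n I := by
  funext q
  rw [quotHilbert_eq_card hI, quotHilbert_eq_card (isHomogeneous_map_algebraMap hI),
    standardExponents, standardExponents, leadingExponents_map_algebraMap]

/-- If `A ⧸ I` has a weakly regular sequence of length `r` in the irrelevant ideal, then the `r`-th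
differential of its Hilbert function has Macaulay's growth bound. -/
theorem hasMacaulayGrowth_iterDifferential_quotHilbert {I : Ideal (MvPolynomial (Fin n) K)}
    (hI : I.IsHomogeneous (homogeneousSubmodule (Fin n) K)) (h1 : I ≠ ⊤)
    {rs : List (MvPolynomial (Fin n) K)} (hrs : ∀ f ∈ rs, f ∈ idealOfVars (Fin n) K)
    (hreg : RegularSequenceModulo I rs) :
    HasMacaulayGrowth (iterDifferential rs.length (quotHilbert K n I)) := by
  -- A functional not vanishing at 1 would send 1 in the extended ideal to a nonzero constant in I.
  have htop : I.map (map (algebraMap K (AlgebraicClosure K))) ≠ ⊤ := by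
    intro h
    rw [Ideal.ne_top_iff_one] at h1
    rw [Ideal.eq_top_iff_one] at h
    rw [mem_map_iff_forall_applyCoeff] at h
    obtain ⟨φ, hφ⟩ : ∃ φ : Module.Dual K (AlgebraicClosure K), φ 1 ≠ 0 := by
      by_contra! h
      exact one_ne_zero ((Module.forall_dual_apply_eq_zero_iff K _).1 h)
    have e : applyCoeff φ (1 : MvPolynomial (Fin n) (AlgebraicClosure K)) = C (φ 1) := by
      classical
      ext d
      rw [coeff_applyCoeff, coeff_one, coeff_C]
      split_ifs <;> simp
    have := I.mul_mem_left (C (φ 1)⁻¹) (h φ)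
    rw [e, ← C_mul, inv_mul_cancel₀ hφ, C_1] at this
    exact h1 this
  have hrs' : ∀ f ∈ rs.map (map (algebraMap K (AlgebraicClosure K))),
      f ∈ idealOfVars (Fin n) (AlgebraicClosure K) := by
    intro f hf
    obtain ⟨g, hg, rfl⟩ := List.mem_map.1 hf
    have := Ideal.mem_map_of_mem (map (algebraMap K (AlgebraicClosure K))) (hrs g hg)
    rw [Ideal.map_span, ← Set.range_comp] at this
    simpa [Function.comp_def] using this
  obtain ⟨J, hJ, hJH⟩ := exists_quotHilbert_eq_iterDifferential
    (isHomogeneous_map_algebraMap hI) htop hrs' hreg.map_algebraMap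
  rw [List.length_map, quotHilbert_map_algebraMap hI] at hJH
  rw [← hJH]
  exact hasMacaulayGrowth_quotHilbert hJ

end FieldExtension

/-! ### Monomial ideals and free variables -/

section MonomialIdeals

attribute [local instance] MvPolynomial.gradedAlgebra

open MvPolynomial

theorem isLowerSet_of_forall_add_single {σ : Type*} {N : Set (σ →₀ ℕ)}
    (h : ∀ d i, d + Finsupp.single i 1 ∈ N → d ∈ N) : IsLowerSet N := by
  intro b a hab hb
  obtain ⟨c, rfl⟩ := exists_add_of_le hab
  clear hab
  induction hc : c.degree generalizing c with
  | zero =>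
    rw [Finsupp.degree_eq_zero_iff] at hc
    rwa [hc, add_zero] at hb
  | succ k ih =>
    obtain ⟨i, hi⟩ : ∃ i, c i ≠ 0 := by
      by_contra! h0
      have : c = 0 := Finsupp.ext h0
      simp [this] at hc
    obtain ⟨e, rfl⟩ := Finsupp.exists_eq_add_single hi
    rw [← add_assoc] at hb
    refine ih e (h _ _ hb) ?_
    rw [map_add, Finsupp.degree_single] at hc
    omega

variable {σ K : Type*} [Field K] {n : ℕ}

/-- The monomial ideal of the polynomials without terms in a given order ideal of monomials. -/
noncomputable def orderIdealCompl (K : Type*) [Field K] (N : LowerSet (σ →₀ ℕ)) :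
    Ideal (MvPolynomial σ K) where
  carrier := {f | ∀ d ∈ N, coeff d f = 0}
  zero_mem' := by simp
  add_mem' := by
    intro f g hf hg d hd
    rw [coeff_add, hf d hd, hg d hd, add_zero]
  smul_mem' := by
    classical
    intro c f hf d hd
    rw [smul_eq_mul, coeff_mul]
    refine Finset.sum_eq_zero fun x hx => ?_
    rw [Finset.HasAntidiagonal.mem_antidiagonal] at hx
    rw [hf x.2 (N.lower (by rw [← hx]; exact le_add_self) hd), mul_zero]

theorem isHomogeneous_orderIdealCompl (N : LowerSet (σ →₀ ℕ)) :
    (orderIdealCompl K N).IsHomogeneous (homogeneousSubmodule σ K) := by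
  rw [isHomogeneous_ideal_iff]
  intro f hf q d hd
  rw [coeff_homogeneousComponent, hf d hd, ite_self]

theorem orderIdealCompl_ne_top {N : LowerSet (σ →₀ ℕ)} (h : 0 ∈ N) :
    orderIdealCompl K N ≠ ⊤ := by
  rw [Ideal.ne_top_iff_one]
  intro h1
  have := h1 0 h
  simp at this

theorem regularModulo_X {N : LowerSet (σ →₀ ℕ)} {i : σ}
    (h : ∀ d ∈ N, d + Finsupp.single i 1 ∈ N) : RegularModulo (orderIdealCompl K N) (X i) := by
  intro f hf d hd
  have := hf _ (h d hd)
  rwa [add_comm, coeff_X_mul] at this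

/-- The members of an order ideal of monomials that do not involve the variable `x_i`. -/
def LowerSet.restrictVar (N : LowerSet (σ →₀ ℕ)) (i : σ) : LowerSet (σ →₀ ℕ) :=
  ⟨{d | d ∈ N ∧ d i = 0}, fun _ _ hab hb =>
    ⟨N.lower hab hb.1, Nat.le_zero.1 ((hab i).trans hb.2.le)⟩⟩

theorem LowerSet.mem_restrictVar {N : LowerSet (σ →₀ ℕ)} {i : σ} {d : σ →₀ ℕ} :
    d ∈ N.restrictVar i ↔ d ∈ N ∧ d i = 0 := Iff.rfl

theorem orderIdealCompl_sup_span_X (N : LowerSet (σ →₀ ℕ)) (i : σ) :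
    orderIdealCompl K N ⊔ Ideal.span {X i} = orderIdealCompl K (N.restrictVar i) := by
  classical
  apply le_antisymm
  · refine sup_le (fun f hf d hd => hf d hd.1) ?_
    rw [Ideal.span_singleton_le_iff_mem]
    intro d hd
    rw [coeff_X, if_neg]
    rintro rfl
    simpa using hd.2
  · intro f hf
    rw [← support_sum_monomial_coeff f]
    refine Ideal.sum_mem _ fun d hd => ?_
    by_cases hN : d ∈ N
    · have h0 : d i ≠ 0 := fun h0 => mem_support_iff.1 hd (hf d ⟨hN, h0⟩)
      obtain ⟨e, rfl⟩ := Finsupp.exists_eq_add_single h0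
      refine Ideal.mem_sup_right (Ideal.mem_span_singleton'.2
        ⟨monomial e (coeff (e + Finsupp.single i 1) f), ?_⟩)
      rw [X, monomial_mul, mul_one]
    · refine Ideal.mem_sup_left fun e he => ?_
      rw [coeff_monomial, if_neg]
      rintro rfl
      exact hN he

/-- The members of an order ideal of monomials that do not involve the variables in a list. -/
def LowerSet.restrictVars (N : LowerSet (σ →₀ ℕ)) : List σ → LowerSet (σ →₀ ℕ)
  | [] => N
  | i :: l => (N.restrictVar i).restrictVars l

theorem LowerSet.mem_restrictVars {N : LowerSet (σ →₀ ℕ)} {l : List σ} {d : σ →₀ ℕ} :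
    d ∈ N.restrictVars l ↔ d ∈ N ∧ ∀ i ∈ l, d i = 0 := by
  induction l generalizing N with
  | nil => simp [restrictVars]
  | cons i l ih => rw [restrictVars, ih, mem_restrictVar, List.forall_mem_cons, and_assoc]

theorem orderIdealCompl_sup_ofList (N : LowerSet (σ →₀ ℕ)) (l : List σ) :
    orderIdealCompl K N ⊔ Ideal.ofList (l.map X) = orderIdealCompl K (N.restrictVars l) := by
  induction l generalizing N with
  | nil => simp [LowerSet.restrictVars]
  | cons i l ih =>
    rw [List.map_cons, Ideal.ofList_cons, ← sup_assoc, orderIdealCompl_sup_span_X, ih,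
      LowerSet.restrictVars]

theorem add_single_mem_restrictVar {N : LowerSet (σ →₀ ℕ)} {i k : σ} (hik : i ≠ k)
    (h : ∀ d ∈ N, d + Finsupp.single k 1 ∈ N) :
    ∀ d ∈ N.restrictVar i, d + Finsupp.single k 1 ∈ N.restrictVar i := by
  rintro d ⟨hd, h0⟩
  exact ⟨h d hd, by rw [Finsupp.add_apply, h0, Finsupp.single_eq_of_ne hik, add_zero]⟩

theorem regularSequenceModulo_map_X {N : LowerSet (σ →₀ ℕ)} {l : List σ} (hl : l.Nodup)
    (h : ∀ i ∈ l, ∀ d ∈ N, d + Finsupp.single i 1 ∈ N) :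
    RegularSequenceModulo (orderIdealCompl K N) (l.map X) := by
  induction l generalizing N with
  | nil => trivial
  | cons i l ih =>
    rw [List.nodup_cons] at hl
    refine ⟨regularModulo_X (h i (by simp)), ?_⟩
    rw [orderIdealCompl_sup_span_X]
    refine ih hl.2 fun k hk => add_single_mem_restrictVar ?_ (h k (by simp [hk]))
    rintro rfl
    exact hl.1 hk

/-- Each free variable is a regular linear form; dividing by it takes one differential and restricts
N to the monomials without it. -/
theorem iterDifferential_quotHilbert_orderIdealCompl {N : LowerSet (Fin n →₀ ℕ)}
    {l : List (Fin n)} (h0 : 0 ∈ N) (hl : l.Nodup)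
    (h : ∀ i ∈ l, ∀ d ∈ N, d + Finsupp.single i 1 ∈ N) :
    iterDifferential l.length (quotHilbert K n (orderIdealCompl K N)) =
      fun q => (quotHilbert K n (orderIdealCompl K (N.restrictVars l)) q : ℤ) := by
  induction l generalizing N with
  | nil => rfl
  | cons i l ih =>
    rw [List.nodup_cons] at hl
    have h1 := quotHilbert_sup_span_linear_eq_differential (isHomogeneous_orderIdealCompl N)
      (orderIdealCompl_ne_top h0) (isHomogeneous_X K i) (regularModulo_X (h i (by simp)))
    rw [List.length_cons, iterDifferential_succ _ _ h1, orderIdealCompl_sup_span_X,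
      LowerSet.restrictVars]
    refine ih ⟨h0, rfl⟩ hl.2 fun k hk => add_single_mem_restrictVar ?_ (h k (by simp [hk]))
    rintro rfl
    exact hl.1 hk

theorem leadingExponents_orderIdealCompl (N : LowerSet (Fin n →₀ ℕ)) :
    leadingExponents (orderIdealCompl K N) = {d | d ∉ N} := by
  classical
  ext d
  constructor
  · rintro ⟨f, hf, h0, rfl⟩ hN
    exact MonomialOrder.coeff_degree_ne_zero_iff.2 h0 (hf _ hN)
  · intro hd
    refine ⟨monomial d 1, fun e he => ?_, by simp, ?_⟩
    · rw [coeff_monomial, if_neg]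
      rintro rfl
      exact hd he
    · rw [MonomialOrder.degree_monomial, if_neg one_ne_zero]

theorem quotHilbert_orderIdealCompl (N : LowerSet (Fin n →₀ ℕ)) (q : ℕ) :
    quotHilbert K n (orderIdealCompl K N) q =
      Nat.card {d : Fin n →₀ ℕ | d.degree = q ∧ d ∈ N} := by
  rw [quotHilbert_eq_card (isHomogeneous_orderIdealCompl N), standardExponents,
    leadingExponents_orderIdealCompl]
  simp

end MonomialIdeals

/-! ### Iterated differentials -/

section Differentials

theorem differential_injective {F G : ℕ → ℤ} (h0 : F 0 = G 0)
    (h : differential F = differential G) : F = G := by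
  funext q
  induction q with
  | zero => exact h0
  | succ q ih =>
    have := congrFun h (q + 1)
    rw [differential, differential] at this
    omega

/-- A differential forgets only the value at 0, and after the first differential that value is
always 1. -/
theorem iterate_differential_injective {F G : ℕ → ℤ} (h0 : F 0 = G 0) (p : ℕ)
    (h : differential^[p] F = differential^[p] G) : F = G := by
  induction p generalizing F G with
  | zero => exact h
  | succ p ih => exact differential_injective h0 (ih rfl h)

theorem iterDifferential_apply_zero {H : ℕ → ℕ} (h0 : H 0 = 1) (p : ℕ) :
    iterDifferential p H 0 = 1 := by
  rcases p with _ | p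
  · simp [iterDifferential, h0]
  · rw [iterDifferential, Function.iterate_succ_apply', differential]

theorem iterDifferential_apply_one {H : ℕ → ℕ} (h0 : H 0 = 1) (p : ℕ) :
    iterDifferential p H 1 = H 1 - p := by
  induction p with
  | zero => simp [iterDifferential]
  | succ p ih =>
    have := iterDifferential_apply_zero h0 p
    rw [iterDifferential] at ih this ⊢
    rw [Function.iterate_succ_apply', differential, ih, this]
    push_cast
    ring

theorem HasMacaulayGrowth.le_apply_one {H : ℕ → ℕ} (h0 : H 0 = 1) {p : ℕ}
    (h : HasMacaulayGrowth (iterDifferential p H)) : p ≤ H 1 := by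
  have := h.1 1
  rw [iterDifferential_apply_one h0] at this
  omega

end Differentials

/-! ### Realisation of admissible differentials and the bound on depth -/

section Sufficiency

attribute [local instance] MvPolynomial.gradedAlgebra

open MvPolynomial

variable {n : ℕ}

/-- The exponents in `n` variables whose part in the first `m` variables lies in one of the
sets `T 0, T 1, …`, which together form an order ideal. -/
noncomputable def cylinder (n m : ℕ) (T : ℕ → Finset (ℕ →₀ ℕ))
    (hdeg : ∀ q, ∀ f ∈ T q, f.degree = q)
    (hT : ∀ q f k, f + Finsupp.single k 1 ∈ T (q + 1) → f ∈ T q) : LowerSet (Fin n →₀ ℕ) :=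
  ⟨{d | ∃ q, (extendExponent d).filter (· < m) ∈ T q}, isLowerSet_of_forall_add_single (by
    rintro d i ⟨q, hq⟩
    rw [extendExponent_add_single, Finsupp.filter_add] at hq
    by_cases hi : (i : ℕ) < m
    · rw [Finsupp.filter_single_of_pos (· < m) hi] at hq
      have := hdeg q _ hq
      rw [Finsupp.degree_add_single] at this
      obtain ⟨q, rfl⟩ : ∃ r, q = r + 1 := ⟨q - 1, by omega⟩
      exact ⟨q, hT _ _ _ hq⟩
    · rw [Finsupp.filter_single_of_neg (· < m) hi, add_zero] at hq
      exact ⟨q, hq⟩)⟩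

theorem exists_extendExponent_eq {f : ℕ →₀ ℕ} {q : ℕ} (hf : f ∈ degreeMonomials n q) :
    ∃ d : Fin n →₀ ℕ, extendExponent d = f := by
  refine ⟨Finsupp.equivFunOnFinite.symm fun i => f i, Finsupp.ext fun k => ?_⟩
  rcases lt_or_ge k n with hk | hk
  · exact extendExponent_apply _ (⟨k, hk⟩ : Fin n)
  · rw [(mem_degreeMonomials.1 hf).2 k hk]
    exact (mem_degreeMonomials.1 (extendExponent_mem _)).2 k hk

theorem filter_extendExponent_eq_self {m : ℕ} {d : Fin n →₀ ℕ}
    (h : ∀ i : Fin n, m ≤ i → d i = 0) : (extendExponent d).filter (· < m) = extendExponent d := by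
  rw [Finsupp.filter_eq_self_iff]
  intro k hk
  by_contra hkm
  rcases lt_or_ge k n with hkn | hkn
  · exact hk ((extendExponent_apply d ⟨k, hkn⟩).trans (h ⟨k, hkn⟩ (by simpa using hkm)))
  · exact hk ((mem_degreeMonomials.1 (extendExponent_mem d)).2 k hkn)

/-- If the `p`-th differential of `H` has Macaulay's growth bound, then `H` is the Hilbert function
of a quotient with a regular sequence of length `p`. -/
theorem exists_regular_of_hasMacaulayGrowth (K : Type*) [Field K] {H : ℕ → ℕ} (h0 : H 0 = 1)
    (h1 : H 1 ≤ n) {p : ℕ} (hp : HasMacaulayGrowth (iterDifferential p H)) :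
    ∃ (I : Ideal (MvPolynomial (Fin n) K)) (rs : List (MvPolynomial (Fin n) K)),
      I.IsHomogeneous (homogeneousSubmodule (Fin n) K) ∧ quotHilbert K n I = H ∧
      (∀ f ∈ rs, f ∈ idealOfVars (Fin n) K) ∧
      RingTheory.Sequence.IsRegular (MvPolynomial (Fin n) K ⧸ I) rs ∧ rs.length = p := by
  have hpH := hp.le_apply_one h0
  set G : ℕ → ℕ := fun q => (iterDifferential p H q).toNat with hG
  have hGH : ∀ q, (G q : ℤ) = iterDifferential p H q := fun q => Int.toNat_of_nonneg (hp.1 q)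
  have hG0 : G 0 = 1 := by
    have := hGH 0
    rw [iterDifferential_apply_zero h0] at this
    exact_mod_cast this
  have hG1 : G 1 + p = H 1 := by
    have := hGH 1
    rw [iterDifferential_apply_one h0] at this
    omega
  obtain ⟨T, hcard, hsub, hcl⟩ := exists_orderIdeal_monomials hG0 fun q hq => by
    have := hp.2 q hq
    rw [← hGH, ← hGH, Int.toNat_natCast] at this
    exact_mod_cast this
  have hdeg : ∀ q, ∀ f ∈ T q, f.degree = q := fun q f hf => (mem_degreeMonomials.1 (hsub q hf)).1
  -- Since G 1 + p = H 1 ≤ n, the monomials in T use only the first m variables, which leaves the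
  -- last p free.
  set m := n - p with hm
  set N := cylinder n m T hdeg hcl with hN
  have hmem : ∀ d, d ∈ N ↔ ∃ q, (extendExponent d).filter (· < m) ∈ T q := fun _ => Iff.rfl
  set l : List (Fin n) := (List.finRange n).drop m with hl
  have hlmem : ∀ i : Fin n, i ∈ l ↔ m ≤ i := by
    intro i
    rw [hl, List.mem_drop_iff_getElem]
    constructor
    · rintro ⟨j, hj, rfl⟩
      simp
    · intro hi
      refine ⟨i - m, by have := i.2; simp; omega, ?_⟩
      ext
      simp
      omega
  have hlen : l.length = p := by simp [hl]; omega
  have hnodup : l.Nodup := (List.nodup_finRange n).sublist (List.drop_sublist _ _)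
  have hN0 : (0 : Fin n →₀ ℕ) ∈ N := by
    refine (hmem 0).2 ⟨0, ?_⟩
    have hne : (T 0).Nonempty := Finset.card_pos.1 (by rw [hcard, hG0]; exact one_pos)
    obtain ⟨f, hf⟩ := hne
    have hf0 := (Finsupp.degree_eq_zero_iff f).1 (hdeg 0 f hf)
    rw [hf0] at hf
    rwa [extendExponent, Finsupp.mapDomain_zero, Finsupp.filter_zero]
  have hadd : ∀ i ∈ l, ∀ d ∈ N, d + Finsupp.single i 1 ∈ N := by
    intro i hi d hd
    rw [hmem] at hd ⊢
    have := (hlmem i).1 hi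
    rwa [extendExponent_add_single, Finsupp.filter_add,
      Finsupp.filter_single_of_neg (· < m) (by omega), add_zero]
  have hhilb : (fun q => (quotHilbert K n (orderIdealCompl K (N.restrictVars l)) q : ℤ)) =
      iterDifferential p H := by
    funext q
    rw [← hGH, ← hcard, quotHilbert_orderIdealCompl, ← Nat.card_image_of_injective
      (extendExponent_injective (n := n)), Nat.card_coe_set_eq, ← Set.ncard_coe_finset]
    congr 2
    ext f
    constructor
    · rintro ⟨d, ⟨hd, hdN⟩, rfl⟩
      rw [LowerSet.mem_restrictVars, hmem] at hdN
      obtain ⟨⟨r, hr⟩, h0⟩ := hdN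
      rw [filter_extendExponent_eq_self fun i hi => h0 i ((hlmem i).2 hi)] at hr
      have h2 := hdeg r _ hr
      rw [(mem_degreeMonomials.1 (extendExponent_mem d)).1, hd] at h2
      rwa [h2]
    · intro hf
      have hf' := degreeMonomials_mono (show G 1 ≤ n by omega) q (hsub q hf)
      obtain ⟨d, rfl⟩ := exists_extendExponent_eq hf'
      have hd0 : ∀ i : Fin n, m ≤ i → d i = 0 := fun i hi => by
        rw [← extendExponent_apply]
        exact (mem_degreeMonomials.1 (hsub q hf)).2 i (by omega)
      refine ⟨d, ⟨?_, LowerSet.mem_restrictVars.2 ⟨(hmem d).2 ⟨q, ?_⟩, fun i hi =>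
        hd0 i ((hlmem i).1 hi)⟩⟩, rfl⟩
      · rw [← hdeg q _ hf, (mem_degreeMonomials.1 (extendExponent_mem d)).1]
      · rwa [filter_extendExponent_eq_self hd0]
  refine ⟨orderIdealCompl K N, l.map X, isHomogeneous_orderIdealCompl N, ?_, ?_, ?_, by simpa⟩
  · have h2 := iterDifferential_quotHilbert_orderIdealCompl (K := K) hN0 hnodup hadd
    rw [hlen, hhilb] at h2
    have h3 := iterate_differential_injective (F := fun q =>
      (quotHilbert K n (orderIdealCompl K N) q : ℤ)) (G := fun q => (H q : ℤ)) ?_ p h2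
    · funext q
      exact_mod_cast congrFun h3 q
    · rw [h0, quotHilbert_zero (orderIdealCompl_ne_top hN0)]
  · intro f hf
    obtain ⟨i, -, rfl⟩ := List.mem_map.1 hf
    exact Ideal.subset_span ⟨i, rfl⟩
  · refine isRegular_of_regularSequenceModulo (regularSequenceModulo_map_X hnodup hadd) ?_
    rw [orderIdealCompl_sup_ofList]
    exact orderIdealCompl_ne_top (LowerSet.mem_restrictVars.2 ⟨hN0, by simp⟩)

theorem quotDepth_le {K : Type*} [Field K] {H : ℕ → ℕ} (h0 : H 0 = 1) {b : ℕ}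
    (hb : ∀ p, HasMacaulayGrowth (iterDifferential p H) → p ≤ b)
    {I : Ideal (MvPolynomial (Fin n) K)} (hI : I.IsHomogeneous (homogeneousSubmodule (Fin n) K))
    (hIH : quotHilbert K n I = H) : quotDepth K n I ≤ b := by
  have htop : I ≠ ⊤ := by
    -- The zero ring has Hilbert function 0, which H 0 = 1 excludes.
    rintro rfl
    have := Ideal.Quotient.subsingleton_iff.2 (rfl : (⊤ : Ideal (MvPolynomial (Fin n) K)) = ⊤)
    have h2 := congrFun hIH 0
    rw [h0, quotHilbert, Module.finrank_zero_of_subsingleton] at h2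
    exact zero_ne_one h2
  refine iSup₂_le fun rs hrs => ?_
  have := hasMacaulayGrowth_iterDifferential_quotHilbert hI htop hrs.1
    (isWeaklyRegular_iff_regularSequenceModulo.1 hrs.2.toIsWeaklyRegular)
  rw [hIH] at this
  exact_mod_cast hb _ this

end Sufficiency

/-! ### Equality of the two maxima -/

theorem theorem2p2 (K : Type*) [Field K] (n : ℕ) (H : ℕ → ℕ)
    (h0 : H 0 = 1) (h1 : H 1 ≤ n)
    (hH : ∀ q, 1 ≤ q → H (q + 1) ≤ macaulayPow q (H q)) :
    ∃ b : ℕ, IsGreatest (depthSet K n H) b ∧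
      IsGreatest {p : ℕ | HasMacaulayGrowth (iterDifferential p H)} b := by
  have hle : ∀ p ∈ {p : ℕ | HasMacaulayGrowth (iterDifferential p H)}, p ≤ H 1 :=
    fun p hp => HasMacaulayGrowth.le_apply_one h0 hp
  have hne : {p : ℕ | HasMacaulayGrowth (iterDifferential p H)}.Nonempty :=
    ⟨0, fun q => Int.natCast_nonneg _, fun q hq => by
      have := hH q hq
      simpa [iterDifferential] using this⟩
  have hbdd : BddAbove {p : ℕ | HasMacaulayGrowth (iterDifferential p H)} := ⟨H 1, hle⟩
  have hgreat : IsGreatest {p : ℕ | HasMacaulayGrowth (iterDifferential p H)} (sSup _) :=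
    ⟨Nat.sSup_mem hne hbdd, fun p hp => le_csSup hbdd hp⟩
  set b := sSup {p : ℕ | HasMacaulayGrowth (iterDifferential p H)}
  refine ⟨b, ⟨⟨(hle b hgreat.1).trans h1, ?_⟩, ?_⟩, hgreat⟩
  · obtain ⟨I, rs, hI, hIH, hrs, hreg, hlen⟩ := exists_regular_of_hasMacaulayGrowth K h0 h1 hgreat.1
    -- The construction only gives depth at least b; maximality of b gives the other inequality.
    refine ⟨I, hI, hIH, le_antisymm (quotDepth_le h0 hgreat.2 hI hIH) ?_⟩
    rw [← hlen]
    exact le_iSup₂_of_le rs ⟨hrs, hreg⟩ le_rfl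
  · rintro r ⟨-, I, hI, hIH, hr⟩
    have := quotDepth_le h0 hgreat.2 hI hIH
    rw [hr] at this
    exact_mod_cast this
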